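/- **Setting.** An *operational-probabilistic theory* consists of: a symmetric monoidal category whose objects are called systems, whose arrows $A\to B$ are called events (or transformations) of type $A\to B$, and whose unit $I$ is the trivial system; a collection of finite outcome sets closed under Cartesian products; for all systems $A,B$ and outcome sets $X$, a set of tests $\{T_x\}_{x\in X}$ of events of type $A\to B$; and a map $\mathrm{Prob}$ from the scalars (events $I\to I$) to $[0,1]$. Tests are closed under sequential and parallel composition, every isomorphism is a test with a single outcome, every event occurs in some test, $\sum_x\mathrm{Prob}(s_x)=1$ for every test of type $I\to I$, and $\mathrm{Prob}(s\otimes t)=\mathrm{Prob}(s)\,\mathrm{Prob}(t)$. States of $A$ are events $\rho:I\to A$, effects of $A$ are events $a:A\to I$, and $(a|\rho)=\mathrm{Prob}(a\circ\rho)$. Linear combinations and limits of events of type $A\to B$ are those of the functions $(R,\rho,m)\mapsto \mathrm{Prob}(m\circ(T\otimes \mathrm{id}_R)\circ\rho)$, where $R$ is a system, $\rho$ a state of $A\otimes R$ and $m$ an effect of $B\otimes R$. An event is *deterministic* if it forms a test with a single outcome. A *coarse-graining* of a test $\{T_x\}_{x\in X}$ along $f:X\to Y$ is $\{\sum_{f(x)=y}T_x\}_{y\in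 Y}$; the former *refines* the latter. An event $E$ is *pure* if, whenever a test $\{T'_z\}$ refines a test $\{T_x\}$ along $f$ and $T_{x_0}=E$, there is a probability distribution $p$ on $f^{-1}(x_0)$ with $T'_z=p_zE$ for all $z\in f^{-1}(x_0)$ (no condition if this fibre is empty). An event $E$ is *internal* if for every event $F$ of the same type $E=\lambda F+G$ with $\lambda>0$ and an event $G$ such that $\lambda F$ and $G$ are two outcomes of one test. A state $\rho$ is *normalized* if $\sup_a(a|\rho)=1$; an effect $a$ is *normalized* if $(a|\rho)=1$ for some state $\rho$. Write $\mathsf{PurSt}_1(A)$ and $\mathsf{PurEff}_1(A)$ for the sets of pure normalized states and pure normalized effects of $A$. An effect $a$ *identifies* a state $\alpha$ if, for all states $\rho$ of $A$, $(a|\rho)=1$ if and only if $\rho=\alpha$. **Assumptions.** Separation: two events of the same type that give the same function of $(R,\rho,m)$ are equal. Closure under coarse-graining: coarse-grainings of tests along maps to finite sets are tests. Finite-dimensionality: the states of each system, as functions of its effects, span a finite-dimensional space. Non-determinism: some scalar has probability different from $0$ and $1$. Closure under limits: an element of the span of the events of type $A\to B$ that is a pointwise limit of a sequence of such events is an event.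 Moreover: 1. *Causality*: for every preparation-test $\{\rho_x\}$ of $A$ and observation-tests $\{m_y\}$, $\{m'_z\}$ of $A$, $\sum_y(m_y|\rho_x)=\sum_z(m'_z|\rho_x)$ for all $x$; and if $\{T_x\}_{x\in X}$ is a test of type $A\to B$ and $\{S^{(x)}_y\}_{y\in Y_x}$ are tests of type $B\to C$, then $\{S^{(x)}_y\circ T_x\}_{x\in X,\,y\in Y_x}$ is a test. 2. *Purity of Composition*: $S\circ T$ is pure if $S$ and $T$ are pure events of matching types. 3. *Local Tomography*: states $\rho,\rho'$ of $A\otimes B$ with $(a\otimes b|\rho)=(a\otimes b|\rho')$ for all effects $a$ of $A$ and $b$ of $B$ are equal. 4. *Perfect State Discrimination*: for every normalized non-internal state $\rho_0$ of $A$ there are a state $\rho_1$ and a test $\{m_0,m_1\}$ of type $A\to I$ with $(m_i|\rho_j)=\delta_{ij}$. 5. *Ideal Compression*: for every deterministic state $\rho$ of $A$ there are a system $B$ and a deterministic event $E:A\to B$ such that (i) for every ensemble decomposition $\{\rho_x\}$ of $\rho$ (a test of type $I\to A$ with sum $\rho$) there is a deterministic $D:B\to A$ with $D\circ E\circ\rho_x=\rho_x$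 for all $x$, and (ii) every state $\sigma$ of $B$ has the form $\sigma=\lambda\,E\circ\rho_{x_0}$ with $\lambda\ge0$ and $\rho_{x_0}$ a member of an ensemble decomposition of $\rho$. 6. *Purification*: every state $\rho$ of $A$ has a purification, i.e. a system $E$, a pure state $\Psi$ of $A\otimes E$ and a deterministic effect $e$ of $E$ with $(\mathrm{id}_A\otimes e)\circ\Psi=\rho$; and if $(E,\Psi,e)$ and $(E,\Psi',e')$ are purifications of $\rho$ with the same $E$, then $\Psi'=(\mathrm{id}_A\otimes U)\circ\Psi$ and $e'\circ U=e$ for some isomorphism $U:E\to E$. **Theorem (state–effect duality).** Under these assumptions, for every system $A$: (a) there exists a bijection $\dagger:\mathsf{PurSt}_1(A)\to\mathsf{PurEff}_1(A)$ with $(\alpha^\dagger|\alpha)=1$ for all $\alpha\in\mathsf{PurSt}_1(A)$; (b) every $a\in\mathsf{PurEff}_1(A)$ identifies exactly one state $\alpha\in\mathsf{PurSt}_1(A)$; (c) if two pure effects of $A$ identify the same state, then they are equal. -/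

import Mathlib

open CategoryTheory MonoidalCategory Filter Topology

universe u v

/-- An operational structure over the symmetric monoidal category of events: `Sys` is the set of
systems, `A ⟶ B` the set of events of type `A → B`, `𝟙_ Sys` the trivial system, the braiding is
the swap.  `Tests A B X` is the set of tests of type `A → B` with outcomes in `X`. -/
structure OperationalStructure (Sys : Type u) [Category.{v} Sys] [MonoidalCategory Sys]
    [SymmetricCategory Sys] where
  /-- The collection of outcome sets. -/
  Outcomes : Set Type
  finite_of_mem : ∀ {X : Type}, X ∈ Outcomes → Finite X
  prod_mem : ∀ {X Y : Type}, X ∈ Outcomes → Y ∈ Outcomes → (X × Y) ∈ Outcomes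
  /-- The tests of type `A → B` with outcomes in `X`. -/
  Tests : ∀ (A B : Sys) (X : Type), Set (X → (A ⟶ B))
  mem_outcomes : ∀ {A B : Sys} {X : Type} {t : X → (A ⟶ B)}, t ∈ Tests A B X → X ∈ Outcomes
  /-- Events are the possible occurrences in tests. -/
  exists_test : ∀ {A B : Sys} (T : A ⟶ B),
    ∃ (X : Type) (t : X → (A ⟶ B)) (x : X), t ∈ Tests A B X ∧ t x = T
  /-- Closure of the tests under sequential composition. -/
  seq_mem : ∀ {A B C : Sys} {X Y : Type} {t : X → (A ⟶ B)} {s : Y → (B ⟶ C)},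
    t ∈ Tests A B X → s ∈ Tests B C Y → (fun z : X × Y => t z.1 ≫ s z.2) ∈ Tests A C (X × Y)
  /-- Closure of the tests under parallel composition. -/
  par_mem : ∀ {A A' B B' : Sys} {X Y : Type} {t : X → (A ⟶ A')} {s : Y → (B ⟶ B')},
    t ∈ Tests A A' X → s ∈ Tests B B' Y →
      (fun z : X × Y => t z.1 ⊗ₘ s z.2) ∈ Tests (A ⊗ B) (A' ⊗ B') (X × Y)
  /-- Reversible events are deterministic tests. -/
  reversible_mem : ∀ {A B : Sys} (U : A ≅ B),
    ∃ (X : Type) (_ : Unique X), (fun _ : X => U.hom) ∈ Tests A B X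

/-- An operational-probabilistic theory: an operational structure together with a probabilistic
structure, that is, an assignment of probabilities to the scalars. -/
structure OPT (Sys : Type u) [Category.{v} Sys] [MonoidalCategory Sys] [SymmetricCategory Sys]
    extends OperationalStructure Sys where
  /-- The probability of a scalar. -/
  Prob : (𝟙_ Sys ⟶ 𝟙_ Sys) → ℝ
  prob_nonneg : ∀ s, 0 ≤ Prob s
  prob_le_one : ∀ s, Prob s ≤ 1
  consistency : ∀ (X : Type) [Fintype X] (s : X → (𝟙_ Sys ⟶ 𝟙_ Sys)),
    s ∈ Tests (𝟙_ Sys) (𝟙_ Sys) X → ∑ x, Prob (s x) = 1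
  independence : ∀ s t : 𝟙_ Sys ⟶ 𝟙_ Sys,
    Prob ((λ_ (𝟙_ Sys)).inv ≫ (s ⊗ₘ t) ≫ (λ_ (𝟙_ Sys)).hom) = Prob s * Prob t

namespace OPT

variable {Sys : Type u} [Category.{v} Sys] [MonoidalCategory Sys] [SymmetricCategory Sys]

/-- The states of `A` (preparation-events). -/
abbrev State (A : Sys) : Type v := 𝟙_ Sys ⟶ A

/-- The effects of `A` (observation-events). -/
abbrev Effect (A : Sys) : Type v := A ⟶ 𝟙_ Sys

/-- The circuits in which an event of type `A → B` can be inserted: a system `R`, a state of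
`A ⊗ R` and an effect of `B ⊗ R`. -/
abbrev Context (A B : Sys) : Type (max u v) := Σ R : Sys, State (A ⊗ R) × Effect (B ⊗ R)

variable (Θ : OPT Sys)

/-- The probability `(a|ρ)`. -/
def pair {A : Sys} (a : Effect A) (ρ : State A) : ℝ := Θ.Prob (ρ ≫ a)

/-- The real function of the circuits that represents an event.  Linear combinations of events
are linear combinations of these functions. -/
def vec {A B : Sys} (T : A ⟶ B) : Context A B → ℝ :=
  fun c => Θ.Prob (c.2.1 ≫ (T ▷ c.1) ≫ c.2.2)

/-- The separation property: statistically equivalent events are equal. -/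
def SeparationProperty : Prop :=
  ∀ (A B : Sys) (T T' : A ⟶ B), (∀ c : Context A B, Θ.vec T c = Θ.vec T' c) → T = T'

/-- The real vector space spanned by the events of type `A → B`. -/
def TransfR (A B : Sys) : Submodule ℝ (Context A B → ℝ) :=
  Submodule.span ℝ (Set.range (fun T : A ⟶ B => Θ.vec T))

/-- The real vector space spanned by the states of `A`, as functions of the effects of `A`. -/
def StateR (A : Sys) : Submodule ℝ (Effect A → ℝ) :=
  Submodule.span ℝ (Set.range (fun ρ : State A => fun a : Effect A => Θ.pair a ρ))

open Classical in
/-- The collection `t'` is the coarse-graining of `t` relative to the partition of `X` into the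
fibres of `f : X → Y` (fibres may be empty); equivalently, `t` refines `t'`. -/
def IsCoarseGraining {A B : Sys} {X Y : Type} [Fintype X] (t : X → (A ⟶ B)) (f : X → Y)
    (t' : Y → (A ⟶ B)) : Prop :=
  ∀ y, Θ.vec (t' y) = ∑ x with f x = y, Θ.vec (t x)

/-- Closure under coarse-graining. -/
def ClosedUnderCoarseGraining : Prop :=
  ∀ (A B : Sys) (X Y : Type) [Fintype X] [Finite Y] (t : X → (A ⟶ B)) (f : X → Y),
    t ∈ Θ.Tests A B X → ∃ t' ∈ Θ.Tests A B Y, Θ.IsCoarseGraining t f t'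

/-- Every system has a finite-dimensional state space. -/
def FiniteDimensionalSystems : Prop := ∀ A : Sys, FiniteDimensional ℝ (Θ.StateR A)

/-- Some probability is neither `0` nor `1`. -/
def NonDeterministic : Prop := ∃ s : 𝟙_ Sys ⟶ 𝟙_ Sys, Θ.Prob s ≠ 0 ∧ Θ.Prob s ≠ 1

/-- Closure under operational limits: an element of the span of the events that is the limit, in
all circuits, of a sequence of events is an event. -/
def ClosedUnderLimits : Prop :=
  ∀ (A B : Sys) (T : ℕ → (A ⟶ B)) (L : Context A B → ℝ), L ∈ Θ.TransfR A B →
    (∀ c, Tendsto (fun n => Θ.vec (T n) c) atTop (𝓝 (L c))) → ∃ T' : A ⟶ B, Θ.vec T' = L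

/-- Deterministic events: those forming a test with a single outcome. -/
def IsDeterministic {A B : Sys} (T : A ⟶ B) : Prop :=
  ∃ (X : Type) (_ : Unique X), (fun _ : X => T) ∈ Θ.Tests A B X

open Classical in
/-- Pure events: every refinement of a test containing `E` refines `E` trivially.  (A probability
distribution is asked for only if the set of outcomes refining `E` is not empty.) -/
def IsPure {A B : Sys} (E : A ⟶ B) : Prop :=
  ∀ (X Z : Type) [Fintype X] [Fintype Z] (t : X → (A ⟶ B)) (t' : Z → (A ⟶ B)) (f : Z → X),
    t ∈ Θ.Tests A B X → t' ∈ Θ.Tests A B Z → Θ.IsCoarseGraining t' f t →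
    ∀ x₀ : X, t x₀ = E →
      ∃ p : Z → ℝ, (∀ z, 0 ≤ p z) ∧ ((∃ z, f z = x₀) → ∑ z with f z = x₀, p z = 1) ∧
        ∀ z, f z = x₀ → Θ.vec (t' z) = p z • Θ.vec (t x₀)

/-- Two events coexist if they occur as two outcomes of one test. -/
def Coexist {A B : Sys} (F G : A ⟶ B) : Prop :=
  ∃ (X : Type) (t : X → (A ⟶ B)) (x y : X), t ∈ Θ.Tests A B X ∧ x ≠ y ∧ t x = F ∧ t y = G

/-- Internal events: for every event `F` of the same type, `E = λ F + G` with `λ > 0` and with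
`λ F` (the event `F'`) and `G` coexisting. -/
def IsInternal {A B : Sys} (E : A ⟶ B) : Prop :=
  ∀ F : A ⟶ B, ∃ (l : ℝ) (F' G : A ⟶ B), 0 < l ∧ Θ.vec F' = l • Θ.vec F ∧
    Θ.vec E = l • Θ.vec F + Θ.vec G ∧ Θ.Coexist F' G

/-- Normalized states: the operational norm `sup_a (a|ρ)` is `1`. -/
def IsNormalizedState {A : Sys} (ρ : State A) : Prop :=
  IsLUB (Set.range (fun a : Effect A => Θ.pair a ρ)) 1

/-- Normalized effects: `(a|ρ) = 1` for some state `ρ`. -/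
def IsNormalizedEffect {A : Sys} (a : Effect A) : Prop := ∃ ρ : State A, Θ.pair a ρ = 1

/-- The states of the family `ρ` are perfectly distinguishable. -/
def PerfectlyDistinguishable {A : Sys} {X : Type} (ρ : X → State A) : Prop :=
  ∃ m ∈ Θ.Tests A (𝟙_ Sys) X,
    (∀ x, Θ.pair (m x) (ρ x) = 1) ∧ ∀ x x', x ≠ x' → Θ.pair (m x) (ρ x') = 0

/-- The preparation-test `r` is an ensemble decomposition of the state `ρ`. -/
def IsEnsembleOf {A : Sys} {X : Type} [Fintype X] (r : X → State A) (ρ : State A) : Prop :=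
  r ∈ Θ.Tests (𝟙_ Sys) A X ∧ Θ.vec ρ = ∑ x, Θ.vec (r x)

/-- The encoding `E` is lossless for the collection `r` of states. -/
def IsLosslessForTest {A B : Sys} {X : Type} (E : A ⟶ B) (r : X → State A) : Prop :=
  ∃ D : B ⟶ A, Θ.IsDeterministic D ∧ ∀ x, r x ≫ E ≫ D = r x

/-- The encoding `E` is lossless for the state `ρ`. -/
def IsLosslessFor {A B : Sys} (E : A ⟶ B) (ρ : State A) : Prop :=
  ∀ (X : Type) [Fintype X] (r : X → State A), Θ.IsEnsembleOf r ρ → Θ.IsLosslessForTest E r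

/-- Maximal efficiency: every state of `B` is a non-negative multiple of a codeword. -/
def IsMaximallyEfficientFor {A B : Sys} (E : A ⟶ B) (ρ : State A) : Prop :=
  ∀ σ : State B, ∃ (X : Type) (_ : Fintype X) (r : X → State A) (x₀ : X) (l : ℝ),
    Θ.IsEnsembleOf r ρ ∧ 0 ≤ l ∧ Θ.vec σ = l • Θ.vec (r x₀ ≫ E)

/-- `E` is an ideal compression of `ρ`. -/
def IsIdealCompression {A B : Sys} (E : A ⟶ B) (ρ : State A) : Prop :=
  Θ.IsDeterministic E ∧ Θ.IsLosslessFor E ρ ∧ Θ.IsMaximallyEfficientFor E ρ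

/-- Applying the effect `e` to the second half of a state of `A ⊗ E`. -/
def applyRight {A E : Sys} (Ψ : State (A ⊗ E)) (e : Effect E) : State A :=
  Ψ ≫ (A ◁ e) ≫ (ρ_ A).hom

/-- `(E, Ψ, e)` is a purification of the state `ρ` of `A`. -/
def IsPurification {A E : Sys} (Ψ : State (A ⊗ E)) (e : Effect E) (ρ : State A) : Prop :=
  Θ.IsPure Ψ ∧ Θ.IsDeterministic e ∧ applyRight Ψ e = ρ

/-- No signalling from the future to the past: the probability of the outcomes of a
preparation-test does not depend on the choice of the subsequent observation-test. -/
def NoSignallingFromFuture : Prop :=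
  ∀ (A : Sys) (X Y₀ Y₁ : Type) [Fintype Y₀] [Fintype Y₁] (r : X → State A)
    (m₀ : Y₀ → Effect A) (m₁ : Y₁ → Effect A),
    r ∈ Θ.Tests (𝟙_ Sys) A X → m₀ ∈ Θ.Tests A (𝟙_ Sys) Y₀ → m₁ ∈ Θ.Tests A (𝟙_ Sys) Y₁ →
    ∀ x, ∑ y, Θ.pair (m₀ y) (r x) = ∑ y, Θ.pair (m₁ y) (r x)

/-- Conditional tests, in which the choice of the second test depends on the outcome of the first
one, are tests. -/
def HasConditionalTests : Prop :=
  ∀ (A B C : Sys) (X : Type) (Y : X → Type) (t : X → (A ⟶ B)) (s : ∀ x, Y x → (B ⟶ C)),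
    t ∈ Θ.Tests A B X → (∀ x, s x ∈ Θ.Tests B C (Y x)) →
      (fun z : Σ x, Y x => t z.1 ≫ s z.1 z.2) ∈ Θ.Tests A C (Σ x, Y x)

/-- Causality, with the possibility of conditional tests. -/
def Causality : Prop := Θ.NoSignallingFromFuture ∧ Θ.HasConditionalTests

/-- Purity of Composition. -/
def PurityOfComposition : Prop :=
  ∀ (A B C : Sys) (S : A ⟶ B) (T : B ⟶ C), Θ.IsPure S → Θ.IsPure T → Θ.IsPure (S ≫ T)

/-- Local Tomography: product effects separate the states of every bipartite system. -/
def LocalTomography : Prop :=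
  ∀ (A B : Sys) (ρ ρ' : State (A ⊗ B)),
    (∀ (a : Effect A) (b : Effect B),
      Θ.pair ((a ⊗ₘ b) ≫ (λ_ (𝟙_ Sys)).hom) ρ = Θ.pair ((a ⊗ₘ b) ≫ (λ_ (𝟙_ Sys)).hom) ρ') →
    ρ = ρ'

/-- Perfect State Discrimination: every normalized non-internal state can be perfectly
distinguished from some other state. -/
def PerfectStateDiscrimination : Prop :=
  ∀ (A : Sys) (ρ : State A), Θ.IsNormalizedState ρ → ¬ Θ.IsInternal ρ →
    ∃ ρ' : State A, Θ.PerfectlyDistinguishable ![ρ, ρ']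

/-- Ideal Compression: every (deterministic) state can be compressed in an ideal way. -/
def IdealCompression : Prop :=
  ∀ (A : Sys) (ρ : State A), Θ.IsDeterministic ρ →
    ∃ (B : Sys) (E : A ⟶ B), Θ.IsIdealCompression E ρ

/-- Purification: every state has a purification, which is essentially unique: two purifications
with the same purifying system differ by a reversible transformation of it. -/
def Purification : Prop :=
  ∀ (A : Sys) (ρ : State A),
    (∃ (E : Sys) (Ψ : State (A ⊗ E)) (e : Effect E), Θ.IsPurification Ψ e ρ) ∧
    ∀ (E : Sys) (Ψ Ψ' : State (A ⊗ E)) (e e' : Effect E),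
      Θ.IsPurification Ψ e ρ → Θ.IsPurification Ψ' e' ρ →
        ∃ U : E ≅ E, Ψ' = Ψ ≫ (A ◁ U.hom) ∧ U.hom ≫ e' = e

/-- The pure normalized states of `A`. -/
def PurSt₁ (A : Sys) : Set (State A) := {α | Θ.IsPure α ∧ Θ.IsNormalizedState α}

/-- The pure normalized effects of `A`. -/
def PurEff₁ (A : Sys) : Set (Effect A) := {a | Θ.IsPure a ∧ Θ.IsNormalizedEffect a}

/-- The effect `a` identifies the state `α`: `(a|ρ) = 1` if and only if `ρ = α`. -/
def Identifies {A : Sys} (a : Effect A) (α : State A) : Prop :=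
  ∀ ρ : State A, Θ.pair a ρ = 1 ↔ ρ = α

end OPT

set_option linter.unusedSectionVars false

namespace OPT

variable {Sys : Type u} [Category.{v} Sys] [MonoidalCategory Sys] [SymmetricCategory Sys]
  {Θ : OPT Sys}

/-! Purity, a statement about refinements of tests, is first traded for extremality in the cone of
events (`RayPure`), where convex geometry applies: finite-dimensionality and closure under limits
make the state space compact, conditional tests give mixtures and ensembles, and repetition until
success gives normalization.

States and effects are linked by a faithful bipartite state `Ψ` of `A ⊗ B`: purify an internal state
of `A` and compress the purifying system (`exists_faithful`). Essential uniqueness of purifications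
yields `steering`, so that the effects of `A` correspond additively to the summands of the marginal
of `Ψ` on `B`, and extremal effects correspond to extremal states up to a factor.

One state per effect: let an extremal effect `a` be certain on `ρ`, with purification `Φ`. Applying
`a` to `Φ` gives a pure state by Purity of Composition, and certainty makes it the marginal of `Φ`
on the purifying system. A bipartite state with an extremal marginal is a product, so `ρ` is
extremal (`rayPure_of_pair_eq_one`). All states on which `a` is certain are thus extremal; they form
a convex set, which must be a single point.

An effect for every state: remove from the marginal on `B` as much as possible of a pure state `β`.
The effect steering to that multiple of `β` is extremal. The remainder, if not zero, is not
internal, so Perfect State Discrimination yields an effect of `B` that vanishes on it and steers to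
a state where the extremal effect is certain. Transitivity of the reversible transformations on pure
states carries this to every pure state.

One effect per state: let `Ψ` have an invariant marginal on `A`. If `a` is certain on `α` and steers
to `q β`, then an extremal effect certain on `β` steers back to `q α` with the same `q`
(`exists_conjugate`). Two extremal effects certain on `α` therefore have proportional, hence equal,
conjugates; they steer to the same state and coincide. -/

/-- The standing assumptions on the theory. -/
structure Principles (Θ : OPT Sys) : Prop where
  separation : Θ.SeparationProperty
  coarseGraining : Θ.ClosedUnderCoarseGraining
  finiteDim : Θ.FiniteDimensionalSystems
  nonDet : Θ.NonDeterministic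
  limits : Θ.ClosedUnderLimits
  causality : Θ.Causality
  purityOfComposition : Θ.PurityOfComposition
  localTomography : Θ.LocalTomography
  perfectStateDiscrimination : Θ.PerfectStateDiscrimination
  idealCompression : Θ.IdealCompression
  purification : Θ.Purification

/-! ### Parallel composition of states and effects -/

/-- The product of two effects. -/
def prodEff {A B : Sys} (a : Effect A) (b : Effect B) : Effect (A ⊗ B) :=
  (a ⊗ₘ b) ≫ (λ_ (𝟙_ Sys)).hom

/-- The product of two states. -/
def prodState {A B : Sys} (ρ : State A) (σ : State B) : State (A ⊗ B) :=
  (λ_ (𝟙_ Sys)).inv ≫ (ρ ⊗ₘ σ)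

/-- Applying the effect `a` to the first half of a state of `A ⊗ E`. -/
def applyLeft {A E : Sys} (Ψ : State (A ⊗ E)) (a : Effect A) : State E :=
  Ψ ≫ (a ▷ E) ≫ (λ_ E).hom

theorem pair_comp {A B : Sys} (T : A ⟶ B) (ρ : State A) (b : Effect B) :
    Θ.pair b (ρ ≫ T) = Θ.pair (T ≫ b) ρ := by
  simp [pair]

theorem pair_prodEff_right {A B : Sys} (a : Effect A) (b : Effect B) (Ψ : State (A ⊗ B)) :
    Θ.pair (prodEff a b) Ψ = Θ.pair a (applyRight Ψ b) := by
  simp only [pair, prodEff, applyRight, Category.assoc]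
  congr 2
  rw [MonoidalCategory.tensorHom_def', Category.assoc, unitors_equal, rightUnitor_naturality]

theorem pair_prodEff_left {A B : Sys} (a : Effect A) (b : Effect B) (Ψ : State (A ⊗ B)) :
    Θ.pair (prodEff a b) Ψ = Θ.pair b (applyLeft Ψ a) := by
  simp only [pair, prodEff, applyLeft, Category.assoc]
  congr 2
  rw [MonoidalCategory.tensorHom_def, Category.assoc, leftUnitor_naturality]

theorem pair_prodEff_prodState {A B : Sys} (a : Effect A) (b : Effect B) (ρ : State A)
    (σ : State B) :
    Θ.pair (prodEff a b) (prodState ρ σ) = Θ.pair a ρ * Θ.pair b σ := by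
  rw [pair, pair, pair, ← Θ.independence]
  simp [prodEff, prodState]

/-- Independence concerns parallel composition; for scalars it agrees with sequential composition by
the interchange law. -/
theorem prob_comp (s t : 𝟙_ Sys ⟶ 𝟙_ Sys) : Θ.Prob (s ≫ t) = Θ.Prob s * Θ.Prob t := by
  rw [← Θ.independence]
  congr 1
  rw [MonoidalCategory.tensorHom_def, Category.assoc, leftUnitor_naturality, unitors_inv_equal,
    ← rightUnitor_inv_naturality_assoc, unitors_equal]
  simp

theorem applyRight_whiskerLeft {A B C : Sys} (Ψ : State (A ⊗ B)) (T : B ⟶ C) (c : Effect C) :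
    applyRight (Ψ ≫ A ◁ T) c = applyRight Ψ (T ≫ c) := by
  simp [applyRight]

theorem applyRight_whiskerRight {A B C : Sys} (Ψ : State (A ⊗ B)) (T : A ⟶ C) (b : Effect B) :
    applyRight (Ψ ≫ T ▷ B) b = applyRight Ψ b ≫ T := by
  simp only [applyRight, Category.assoc]
  rw [← whisker_exchange_assoc, rightUnitor_naturality]

theorem applyLeft_whiskerLeft {A B C : Sys} (Ψ : State (A ⊗ B)) (T : B ⟶ C) (a : Effect A) :
    applyLeft (Ψ ≫ A ◁ T) a = applyLeft Ψ a ≫ T := by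
  simp only [applyLeft, Category.assoc]
  rw [whisker_exchange_assoc, leftUnitor_naturality]

theorem applyLeft_braiding {A B : Sys} (Ψ : State (A ⊗ B)) (b : Effect B) :
    applyLeft (Ψ ≫ (β_ A B).hom) b = applyRight Ψ b := by
  simp only [applyLeft, applyRight, Category.assoc]
  rw [← BraidedCategory.braiding_naturality_right_assoc, braiding_leftUnitor]

theorem applyRight_braiding {A B : Sys} (Ψ : State (A ⊗ B)) (a : Effect A) :
    applyRight (Ψ ≫ (β_ A B).hom) a = applyLeft Ψ a := by
  simp only [applyLeft, applyRight, Category.assoc]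
  rw [← BraidedCategory.braiding_naturality_left_assoc, braiding_rightUnitor]

/-! ### Events as functions of circuits -/

/-- The effect obtained by completing a circuit for states. -/
def ctxEffect {A : Sys} (c : Context (𝟙_ Sys) A) : Effect A :=
  (ρ_ A).inv ≫ (A ◁ (c.2.1 ≫ (λ_ c.1).hom)) ≫ c.2.2

/-- The state obtained by completing a circuit for effects. -/
def ctxState {A : Sys} (c : Context A (𝟙_ Sys)) : State A :=
  applyRight c.2.1 ((λ_ c.1).inv ≫ c.2.2)

/-- The side system `R` can be absorbed into the effect, so ordinary effects already separate
states. `vec_effect` is the dual remark. -/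
theorem vec_state {A : Sys} (ρ : State A) (c : Context (𝟙_ Sys) A) :
    Θ.vec ρ c = Θ.pair (ctxEffect c) ρ := by
  obtain ⟨R, τ, m⟩ := c
  simp only [vec, pair, ctxEffect]
  congr 1
  rw [rightUnitor_inv_naturality_assoc, ← whisker_exchange_assoc, ← unitors_inv_equal,
    ← leftUnitor_inv_naturality_assoc]
  simp

theorem vec_effect {A : Sys} (a : Effect A) (c : Context A (𝟙_ Sys)) :
    Θ.vec a c = Θ.pair a (ctxState c) := by
  obtain ⟨R, Ψ, m⟩ := c
  simp only [vec, pair, ctxState, applyRight, Category.assoc]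
  congr 2
  rw [← rightUnitor_naturality, whisker_exchange_assoc, ← unitors_equal, leftUnitor_naturality]
  simp

/-- The circuit without side system. -/
def simpleCtx {A B : Sys} (ρ : State A) (b : Effect B) : Context A B :=
  ⟨𝟙_ Sys, ρ ≫ (ρ_ A).inv, (ρ_ B).hom ≫ b⟩

theorem vec_simpleCtx {A B : Sys} (T : A ⟶ B) (ρ : State A) (b : Effect B) :
    Θ.vec T (simpleCtx ρ b) = Θ.pair b (ρ ≫ T) := by
  simp only [vec, pair, simpleCtx, Category.assoc]
  congr 2
  rw [rightUnitor_naturality_assoc]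
  simp

/-! ### Tests and deterministic events -/

theorem pair_nonneg {A : Sys} (a : Effect A) (ρ : State A) : 0 ≤ Θ.pair a ρ := Θ.prob_nonneg _

theorem pair_le_one {A : Sys} (a : Effect A) (ρ : State A) : Θ.pair a ρ ≤ 1 := Θ.prob_le_one _

theorem Principles.event_ext (h : Θ.Principles) {A B : Sys} {T T' : A ⟶ B}
    (hT : ∀ c, Θ.vec T c = Θ.vec T' c) : T = T' := h.separation A B T T' hT

theorem Principles.state_ext (h : Θ.Principles) {A : Sys} {ρ σ : State A}
    (hρ : ∀ a : Effect A, Θ.pair a ρ = Θ.pair a σ) : ρ = σ :=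
  h.event_ext fun c => by rw [vec_state, vec_state, hρ]

theorem Principles.effect_ext (h : Θ.Principles) {A : Sys} {a b : Effect A}
    (hab : ∀ ρ : State A, Θ.pair a ρ = Θ.pair b ρ) : a = b :=
  h.event_ext fun c => by rw [vec_effect, vec_effect, hab]

theorem Principles.mem_of_coarse (h : Θ.Principles) {A B : Sys} {X Y : Type} [Fintype X] [Finite Y]
    {t : X → (A ⟶ B)} (ht : t ∈ Θ.Tests A B X) (f : X → Y) (t' : Y → (A ⟶ B))
    (ht' : Θ.IsCoarseGraining t f t') : t' ∈ Θ.Tests A B Y := by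
  obtain ⟨t'', h1, h2⟩ := h.coarseGraining A B X Y t f ht
  have : t' = t'' := by
    funext y
    exact h.event_ext fun c => by rw [ht' y, h2 y]
  rwa [this]

theorem Principles.mem_reindex (h : Θ.Principles) {A B : Sys} {X Y : Type}
    {t : X → (A ⟶ B)} (ht : t ∈ Θ.Tests A B X) (e : X ≃ Y) :
    (fun y => t (e.symm y)) ∈ Θ.Tests A B Y := by
  classical
  have := Θ.finite_of_mem (Θ.mem_outcomes ht)
  have := Fintype.ofFinite X
  have : Finite Y := Finite.of_equiv X e
  refine h.mem_of_coarse ht e _ fun y => ?_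
  have : (Finset.univ.filter fun x => e x = y) = {e.symm y} := by
    ext x; simp [Equiv.eq_symm_apply]
  rw [Finset.sum_congr (by convert this) fun _ _ => rfl, Finset.sum_singleton]

theorem isDeterministic_of_iso {A B : Sys} (U : A ≅ B) : Θ.IsDeterministic U.hom :=
  Θ.reversible_mem U

theorem isDeterministic_id (A : Sys) : Θ.IsDeterministic (𝟙 A) :=
  Θ.reversible_mem (Iso.refl A)

theorem IsDeterministic.comp {A B C : Sys} {S : A ⟶ B} {T : B ⟶ C} (hS : Θ.IsDeterministic S)
    (hT : Θ.IsDeterministic T) : Θ.IsDeterministic (S ≫ T) := by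
  obtain ⟨X, _, hX⟩ := hS
  obtain ⟨Y, _, hY⟩ := hT
  exact ⟨X × Y, Unique.mk' _, Θ.seq_mem hX hY⟩

theorem IsDeterministic.tensor {A B C D : Sys} {S : A ⟶ B} {T : C ⟶ D} (hS : Θ.IsDeterministic S)
    (hT : Θ.IsDeterministic T) : Θ.IsDeterministic (S ⊗ₘ T) := by
  obtain ⟨X, _, hX⟩ := hS
  obtain ⟨Y, _, hY⟩ := hT
  exact ⟨X × Y, Unique.mk' _, Θ.par_mem hX hY⟩

theorem IsDeterministic.whiskerLeft {A B C : Sys} {S : A ⟶ B} (hS : Θ.IsDeterministic S) :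
    Θ.IsDeterministic (C ◁ S) := by
  rw [← id_tensorHom]; exact (isDeterministic_id C).tensor hS

theorem IsDeterministic.whiskerRight {A B C : Sys} {S : A ⟶ B} (hS : Θ.IsDeterministic S) :
    Θ.IsDeterministic (S ▷ C) := by
  rw [← tensorHom_id]; exact hS.tensor (isDeterministic_id C)

theorem IsDeterministic.prodEff {A B : Sys} {a : Effect A} {b : Effect B}
    (ha : Θ.IsDeterministic a) (hb : Θ.IsDeterministic b) : Θ.IsDeterministic (prodEff a b) :=
  (ha.tensor hb).comp (isDeterministic_of_iso _)

theorem IsDeterministic.prodState {A B : Sys} {ρ : State A} {σ : State B}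
    (hρ : Θ.IsDeterministic ρ) (hσ : Θ.IsDeterministic σ) : Θ.IsDeterministic (prodState ρ σ) :=
  (isDeterministic_of_iso (λ_ (𝟙_ Sys)).symm).comp (hρ.tensor hσ)

theorem Principles.mem_comp (h : Θ.Principles) {A B C : Sys} {X : Type} {t : X → (A ⟶ B)}
    (ht : t ∈ Θ.Tests A B X) {D : B ⟶ C} (hD : Θ.IsDeterministic D) :
    (fun x => t x ≫ D) ∈ Θ.Tests A C X := by
  obtain ⟨Y, _, hY⟩ := hD
  exact h.mem_reindex (Θ.seq_mem ht hY) (Equiv.prodUnique X Y)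

theorem Principles.comp_mem (h : Θ.Principles) {A B C : Sys} {X : Type} {t : X → (B ⟶ C)}
    (ht : t ∈ Θ.Tests B C X) {D : A ⟶ B} (hD : Θ.IsDeterministic D) :
    (fun x => D ≫ t x) ∈ Θ.Tests A C X := by
  obtain ⟨Y, _, hY⟩ := hD
  exact h.mem_reindex (Θ.seq_mem hY ht) (Equiv.uniqueProd X Y)

theorem Principles.whiskerRight_mem (h : Θ.Principles) {A B : Sys} (C : Sys) {X : Type}
    {t : X → (A ⟶ B)} (ht : t ∈ Θ.Tests A B X) :
    (fun x => t x ▷ C) ∈ Θ.Tests (A ⊗ C) (B ⊗ C) X := by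
  obtain ⟨Y, _, hY⟩ := Θ.isDeterministic_id C
  simpa using h.mem_reindex (Θ.par_mem ht hY) (Equiv.prodUnique X Y)

theorem Principles.whiskerLeft_mem (h : Θ.Principles) {A B : Sys} (C : Sys) {X : Type}
    {t : X → (A ⟶ B)} (ht : t ∈ Θ.Tests A B X) :
    (fun x => C ◁ t x) ∈ Θ.Tests (C ⊗ A) (C ⊗ B) X := by
  obtain ⟨Y, _, hY⟩ := Θ.isDeterministic_id C
  simpa using h.mem_reindex (Θ.par_mem hY ht) (Equiv.uniqueProd X Y)

theorem Principles.isDeterministic_iff (h : Θ.Principles) {A B : Sys} {T : A ⟶ B} :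
    Θ.IsDeterministic T ↔ (fun _ : Unit => T) ∈ Θ.Tests A B Unit := by
  constructor
  · rintro ⟨X, _, hX⟩
    exact h.mem_reindex hX (Equiv.ofUnique X Unit)
  · exact fun hT => ⟨Unit, inferInstance, hT⟩

/-- The total event of a test. -/
theorem Principles.exists_sum (h : Θ.Principles) {A B : Sys} {X : Type} [Fintype X]
    {t : X → (A ⟶ B)} (ht : t ∈ Θ.Tests A B X) :
    ∃ T : A ⟶ B, Θ.IsDeterministic T ∧ Θ.vec T = ∑ x, Θ.vec (t x) := by
  obtain ⟨t', h1, h2⟩ := h.coarseGraining A B X Unit t (fun _ => ()) ht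
  refine ⟨t' (), h.isDeterministic_iff.2 h1, ?_⟩
  rw [h2]; simp

open Classical in
theorem Principles.exists_sum_filter (h : Θ.Principles) {A B : Sys} {X : Type} [Fintype X]
    {t : X → (A ⟶ B)} (ht : t ∈ Θ.Tests A B X) (P : X → Prop) :
    ∃ T : A ⟶ B, Θ.vec T = ∑ x with P x, Θ.vec (t x) := by
  obtain ⟨t', h1, h2⟩ := h.coarseGraining A B X Bool t (fun x => decide (P x)) ht
  refine ⟨t' true, ?_⟩
  rw [h2]; simp

/-- Merge all the other outcomes of a test in which `T` occurs. -/
theorem Principles.exists_complement (h : Θ.Principles) {A B : Sys} (T : A ⟶ B) :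
    ∃ T' : A ⟶ B, (fun b : Bool => cond b T T') ∈ Θ.Tests A B Bool := by
  classical
  obtain ⟨X, t, x, ht, rfl⟩ := Θ.exists_test T
  have := Θ.finite_of_mem (Θ.mem_outcomes ht)
  have := Fintype.ofFinite X
  obtain ⟨t', h1, h2⟩ := h.coarseGraining A B X Bool t (fun y => decide (y = x)) ht
  have h3 : t' true = t x := by
    refine h.event_ext fun c => ?_
    rw [h2, Finset.sum_congr (s₂ := {x}) (by ext; simp) fun _ _ => rfl, Finset.sum_singleton]
  refine ⟨t' false, ?_⟩
  convert h1 using 1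
  funext b
  cases b <;> simp [h3]

/-- The argument `a` only witnesses that `A` has some effect, whose test is then coarse-grained to
one outcome. -/
theorem Principles.exists_det_effect (h : Θ.Principles) {A : Sys} (a : Effect A) :
    ∃ u : Effect A, Θ.IsDeterministic u := by
  obtain ⟨a', ha⟩ := h.exists_complement a
  obtain ⟨u, hu, _⟩ := h.exists_sum ha
  exact ⟨u, hu⟩

theorem Principles.exists_det_state (h : Θ.Principles) {A : Sys} (a : State A) :
    ∃ u : State A, Θ.IsDeterministic u := by
  obtain ⟨a', ha⟩ := h.exists_complement a
  obtain ⟨u, hu, _⟩ := h.exists_sum ha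
  exact ⟨u, hu⟩

/-- Every state occurs in a preparation-test, so no-signalling may compare `m` with the one-outcome
test `u`. -/
theorem Principles.sum_pair (h : Θ.Principles) {A : Sys} {u : Effect A} (hu : Θ.IsDeterministic u)
    {X : Type} [Fintype X] {m : X → Effect A} (hm : m ∈ Θ.Tests A (𝟙_ Sys) X) (ρ : State A) :
    ∑ x, Θ.pair (m x) ρ = Θ.pair u ρ := by
  obtain ⟨Y, r, y, hr, rfl⟩ := Θ.exists_test ρ
  simpa using h.causality.1 A Y X Unit r m (fun _ => u) hr hm (h.isDeterministic_iff.1 hu) y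

theorem Principles.det_effect_unique (h : Θ.Principles) {A : Sys} {u u' : Effect A}
    (hu : Θ.IsDeterministic u) (hu' : Θ.IsDeterministic u') : u = u' :=
  h.effect_ext fun ρ => by simpa using h.sum_pair hu' (h.isDeterministic_iff.1 hu) ρ

/-- The complementary effect `u - a`. -/
theorem Principles.exists_compl_effect (h : Θ.Principles) {A : Sys} {u : Effect A}
    (hu : Θ.IsDeterministic u) (a : Effect A) :
    ∃ a' : Effect A, (fun b : Bool => cond b a a') ∈ Θ.Tests A (𝟙_ Sys) Bool ∧
      ∀ ρ, Θ.pair u ρ = Θ.pair a ρ + Θ.pair a' ρ := by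
  obtain ⟨a', ha⟩ := h.exists_complement a
  exact ⟨a', ha, fun ρ => by rw [← h.sum_pair hu ha ρ]; simp⟩

theorem Principles.pair_le (h : Θ.Principles) {A : Sys} {u : Effect A}
    (hu : Θ.IsDeterministic u) (a : Effect A) (ρ : State A) : Θ.pair a ρ ≤ Θ.pair u ρ := by
  obtain ⟨a', -, ha⟩ := h.exists_compl_effect hu a
  linarith [ha ρ, Θ.pair_nonneg a' ρ]

theorem prob_eq_one_of_det {s : 𝟙_ Sys ⟶ 𝟙_ Sys} (hs : Θ.IsDeterministic s) : Θ.Prob s = 1 := by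
  obtain ⟨X, _, hX⟩ := hs
  simpa using Θ.consistency X _ hX

theorem prob_id : Θ.Prob (𝟙 (𝟙_ Sys)) = 1 := prob_eq_one_of_det (isDeterministic_id _)

theorem pair_det {A : Sys} {u : Effect A} {ρ : State A} (hu : Θ.IsDeterministic u)
    (hρ : Θ.IsDeterministic ρ) : Θ.pair u ρ = 1 := prob_eq_one_of_det (hρ.comp hu)

/-- The complement of `ρ` in a binary test has probability zero under `u`, hence under every effect,
so `ρ` equals the total event of that test. -/
theorem Principles.det_of_pair_eq_one (h : Θ.Principles) {A : Sys} {u : Effect A} {ρ : State A}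
    (hu : Θ.IsDeterministic u) (hρ : Θ.pair u ρ = 1) : Θ.IsDeterministic ρ := by
  obtain ⟨ρ', hr⟩ := h.exists_complement ρ
  obtain ⟨σ, hσ, hs⟩ := h.exists_sum hr
  have hp : ∀ a : Effect A, Θ.pair a σ = Θ.pair a ρ + Θ.pair a ρ' := by
    intro a
    have := congrFun hs (simpleCtx (𝟙 _) a)
    simpa [vec_simpleCtx] using this
  have h0 : Θ.pair u ρ' = 0 := by
    have := hp u
    rw [pair_det hu hσ] at this; linarith
  have : ρ = σ := h.state_ext fun a => by
    have h1 := h.pair_le hu a ρ'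
    have h2 := Θ.pair_nonneg a ρ'
    linarith [hp a]
  rwa [this]

theorem Principles.isNormalizedState_iff (h : Θ.Principles) {A : Sys} {u : Effect A}
    (hu : Θ.IsDeterministic u) {ρ : State A} :
    Θ.IsNormalizedState ρ ↔ Θ.pair u ρ = 1 := by
  have : IsGreatest (Set.range (fun a : Effect A => Θ.pair a ρ)) (Θ.pair u ρ) :=
    ⟨⟨u, rfl⟩, by rintro _ ⟨a, rfl⟩; exact h.pair_le hu a ρ⟩
  exact ⟨fun h1 => this.isLUB.unique h1, fun h1 => by
    have := this.isLUB; rwa [h1] at this⟩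

theorem Principles.prob_scalar_ext (h : Θ.Principles) {s t : 𝟙_ Sys ⟶ 𝟙_ Sys}
    (hst : Θ.Prob s = Θ.Prob t) : s = t :=
  h.state_ext fun a => by simp [pair, prob_comp, hst]

/-! ### Mixtures -/

/-- The action of a scalar on a system. -/
def scalar (s : 𝟙_ Sys ⟶ 𝟙_ Sys) (A : Sys) : A ⟶ A := (λ_ A).inv ≫ s ▷ A ≫ (λ_ A).hom

theorem vec_scalar_comp (s : 𝟙_ Sys ⟶ 𝟙_ Sys) {A B : Sys} (T : A ⟶ B) (c : Context A B) :
    Θ.vec (scalar s A ≫ T) c = Θ.Prob s * Θ.vec T c := by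
  obtain ⟨R, Ψ, m⟩ := c
  simp only [vec]
  rw [← prob_comp]
  congr 1
  have h1 : scalar s A ▷ R = scalar s (A ⊗ R) := by
    simp [scalar]
  have h2 : Ψ ≫ scalar s (A ⊗ R) = s ≫ Ψ := by
    simp only [scalar]
    rw [leftUnitor_inv_naturality_assoc, whisker_exchange_assoc, leftUnitor_naturality,
      unitors_equal, rightUnitor_naturality_assoc, unitors_inv_equal, Iso.inv_hom_id_assoc]
  rw [comp_whiskerRight, Category.assoc, h1, reassoc_of% h2]

theorem Principles.scalar_mem (h : Θ.Principles) {X : Type} {s : X → (𝟙_ Sys ⟶ 𝟙_ Sys)}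
    (hs : s ∈ Θ.Tests (𝟙_ Sys) (𝟙_ Sys) X) (A : Sys) :
    (fun x => scalar (s x) A) ∈ Θ.Tests A A X :=
  h.comp_mem (h.mem_comp (h.whiskerRight_mem A hs) (isDeterministic_of_iso (λ_ A)))
    (isDeterministic_of_iso (λ_ A).symm)

theorem Principles.exists_mix_scalar (h : Θ.Principles) {A B : Sys} (s : 𝟙_ Sys ⟶ 𝟙_ Sys)
    (T T' : A ⟶ B) :
    ∃ T'' : A ⟶ B, ∀ c, Θ.vec T'' c = Θ.Prob s * Θ.vec T c + (1 - Θ.Prob s) * Θ.vec T' c := by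
  classical
  obtain ⟨s', hs⟩ := h.exists_complement s
  have hp : Θ.Prob s + Θ.Prob s' = 1 := by simpa using Θ.consistency Bool _ hs
  obtain ⟨T₁, hT⟩ := h.exists_complement T
  obtain ⟨T₁', hT'⟩ := h.exists_complement T'
  -- Toss the coin `s`, then run a test containing `T` or one containing `T'`; the outcomes with
  -- second label `true` add up to the mixture.
  have key := h.causality.2 A A B Bool (fun _ => Bool) _
    (fun b => cond b (fun b' : Bool => cond b' T T₁) (fun b' => cond b' T' T₁'))
    (h.scalar_mem hs A) (by rintro (_ | _) <;> assumption)
  obtain ⟨T'', h''⟩ := h.exists_sum_filter key (fun z => z.2 = true)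
  refine ⟨T'', fun c => ?_⟩
  rw [h'', Finset.sum_filter, Fintype.sum_sigma]
  simp [vec_scalar_comp, ← hp]

/-- Limits of states. -/
theorem Principles.exists_limit (h : Θ.Principles) {A : Sys} (ρ : ℕ → State A)
    (L : Effect A → ℝ) (hL : L ∈ Θ.StateR A)
    (hlim : ∀ a, Tendsto (fun n => Θ.pair a (ρ n)) atTop (𝓝 (L a))) :
    ∃ σ : State A, ∀ a, Θ.pair a σ = L a := by
  -- Closure under limits is about functions of circuits; precomposition with `ctxEffect` turns
  -- functions of effects into these.
  let φ : (Effect A → ℝ) →ₗ[ℝ] (Context (𝟙_ Sys) A → ℝ) := LinearMap.funLeft ℝ ℝ ctxEffect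
  have hφ : ∀ ρ : State A, φ (fun a => Θ.pair a ρ) = Θ.vec ρ := fun ρ => by
    ext c; simp [φ, LinearMap.funLeft_apply, vec_state]
  have hmem : φ L ∈ Θ.TransfR (𝟙_ Sys) A := by
    have : φ L ∈ (Θ.StateR A).map φ := Submodule.mem_map_of_mem hL
    rw [StateR, Submodule.map_span, ← Set.range_comp] at this
    have he : (φ ∘ fun (ρ : State A) (a : Effect A) => Θ.pair a ρ)
      = fun ρ : State A => Θ.vec ρ := funext hφ
    rwa [he] at this
  obtain ⟨σ, hσ⟩ := h.limits (𝟙_ Sys) A ρ (φ L) hmem fun c => by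
    simpa [vec_state, φ, LinearMap.funLeft_apply] using hlim (ctxEffect c)
  have hvec : ∀ a, Θ.pair a σ = Θ.vec σ (simpleCtx (𝟙 _) a) := fun a => by simp [vec_simpleCtx]
  refine ⟨σ, fun a => ?_⟩
  have h1 : Tendsto (fun n => Θ.vec (ρ n) (simpleCtx (𝟙 _) a)) atTop
      (𝓝 (φ L (simpleCtx (𝟙 _) a))) := by
    simpa [vec_state, φ, LinearMap.funLeft_apply] using hlim (ctxEffect (simpleCtx (𝟙 _) a))
  rw [hvec, hσ]
  refine tendsto_nhds_unique h1 ?_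
  simpa [vec_simpleCtx] using hlim a

theorem pair_mem_stateR {A : Sys} (ρ : State A) :
    (fun a : Effect A => Θ.pair a ρ) ∈ Θ.StateR A :=
  Submodule.subset_span ⟨ρ, rfl⟩

theorem pair_scalar (s t : 𝟙_ Sys ⟶ 𝟙_ Sys) : Θ.pair t s = Θ.Prob s * Θ.Prob t := prob_comp s t

/-- The set of probabilities is closed, contains `1`, and contains `0` as the limit of powers of a
non-deterministic scalar `s`. If it missed `p`, the nearest values below and above `p` would bound a
gap, but their mixture with weight `Prob s` lies strictly inside it. -/
theorem Principles.exists_scalar (h : Θ.Principles) {p : ℝ} (h0 : 0 ≤ p) (h1 : p ≤ 1) :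
    ∃ s : 𝟙_ Sys ⟶ 𝟙_ Sys, Θ.Prob s = p := by
  let C : Set ℝ := Set.range Θ.Prob
  have hclosed : IsClosed C := by
    rw [← isSeqClosed_iff_isClosed]
    intro x p hx hp
    choose s hs using hx
    obtain ⟨σ, hσ⟩ := h.exists_limit s (fun t => p * Θ.Prob t) (by
      have := (Θ.StateR (𝟙_ Sys)).smul_mem p (pair_mem_stateR (𝟙 (𝟙_ Sys)))
      convert this using 1
      ext t
      simp [pair_scalar, prob_id]) (fun t => by
        simp only [pair_scalar, hs]
        exact hp.mul_const _)
    refine ⟨σ, ?_⟩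
    simpa [pair_scalar, prob_id] using hσ (𝟙 _)
  have hmix : ∀ s, ∀ y ∈ C, ∀ z ∈ C, Θ.Prob s * y + (1 - Θ.Prob s) * z ∈ C := by
    rintro s _ ⟨y, rfl⟩ _ ⟨z, rfl⟩
    obtain ⟨t, ht⟩ := h.exists_mix_scalar s y z
    refine ⟨t, ?_⟩
    simpa [vec_simpleCtx, pair_scalar, prob_id] using ht (simpleCtx (𝟙 _) (𝟙 _))
  obtain ⟨s, hs0, hs1⟩ := h.nonDet
  have hs0' : 0 < Θ.Prob s := lt_of_le_of_ne (Θ.prob_nonneg s) (Ne.symm hs0)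
  have hs1' : Θ.Prob s < 1 := lt_of_le_of_ne (Θ.prob_le_one s) hs1
  have one_mem : (1 : ℝ) ∈ C := ⟨_, prob_id⟩
  have zero_mem : (0 : ℝ) ∈ C := by
    have hpow : ∀ n : ℕ, Θ.Prob s ^ n ∈ C := by
      intro n
      induction n with
      | zero => simpa using one_mem
      | succ n ih =>
        obtain ⟨t, ht⟩ := ih
        exact ⟨t ≫ s, by rw [prob_comp, ht, pow_succ]⟩
    exact hclosed.mem_of_tendsto (tendsto_pow_atTop_nhds_zero_of_lt_one hs0'.le hs1')
      (Eventually.of_forall hpow)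
  by_contra hp
  have hpC : p ∉ C := fun ⟨s, hs⟩ => hp ⟨s, hs⟩
  have hlo := (hclosed.inter isClosed_Iic).csSup_mem (s := C ∩ Set.Iic p) ⟨0, zero_mem, h0⟩
    ⟨p, fun x hx => hx.2⟩
  have hhi := (hclosed.inter isClosed_Ici).csInf_mem (s := C ∩ Set.Ici p) ⟨1, one_mem, h1⟩
    ⟨p, fun x hx => hx.2⟩
  set y := sSup (C ∩ Set.Iic p)
  set z := sInf (C ∩ Set.Ici p)
  have hyp : y < p := lt_of_le_of_ne hlo.2 fun e => hpC (e ▸ hlo.1)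
  have hpz : p < z := lt_of_le_of_ne hhi.2 fun e => hpC (e ▸ hhi.1)
  have hw := hmix s y hlo.1 z hhi.1
  rcases le_total (Θ.Prob s * y + (1 - Θ.Prob s) * z) p with hle | hle
  · have : Θ.Prob s * y + (1 - Θ.Prob s) * z ≤ y :=
      le_csSup ⟨p, fun x hx => hx.2⟩ ⟨hw, hle⟩
    nlinarith
  · have : z ≤ Θ.Prob s * y + (1 - Θ.Prob s) * z :=
      csInf_le ⟨p, fun x hx => hx.2⟩ ⟨hw, hle⟩
    nlinarith

theorem Principles.exists_mix (h : Θ.Principles) {A B : Sys} {p : ℝ} (h0 : 0 ≤ p) (h1 : p ≤ 1)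
    (T T' : A ⟶ B) :
    ∃ T'' : A ⟶ B, ∀ c, Θ.vec T'' c = p * Θ.vec T c + (1 - p) * Θ.vec T' c := by
  obtain ⟨s, rfl⟩ := h.exists_scalar h0 h1
  exact h.exists_mix_scalar s T T'

theorem Principles.exists_smul (h : Θ.Principles) {A B : Sys} {p : ℝ} (h0 : 0 ≤ p) (h1 : p ≤ 1)
    (T : A ⟶ B) : ∃ T' : A ⟶ B, ∀ c, Θ.vec T' c = p * Θ.vec T c := by
  obtain ⟨s, rfl⟩ := h.exists_scalar h0 h1
  exact ⟨_, vec_scalar_comp s T⟩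

theorem pair_eq_vec {A : Sys} (a : Effect A) (ρ : State A) :
    Θ.pair a ρ = Θ.vec ρ (simpleCtx (𝟙 _) a) := by simp [vec_simpleCtx]

/-! ### The cone of states -/

/-- Normalization: states can be prepared with unit probability. -/
theorem Principles.exists_normalization (h : Θ.Principles) {A : Sys} {u : Effect A}
    (hu : Θ.IsDeterministic u) (ρ : State A) (hρ : 0 < Θ.pair u ρ) :
    ∃ σ : State A, ∀ a, Θ.pair a σ = (Θ.pair u ρ)⁻¹ * Θ.pair a ρ := by
  classical
  obtain ⟨ρ', hr⟩ := h.exists_complement ρ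
  set p := Θ.pair u ρ with hp
  have hp1 : p ≤ 1 := pair_le_one _ _
  have hsum : p + Θ.pair u ρ' = 1 := by
    rw [hp]
    simpa [pair] using Θ.consistency Bool _ (h.mem_comp hr hu)
  -- Repeat until success: when the outcome is `ρ'`, discard the system and prepare `τ` instead.
  -- Iterating from `ρ` produces the partial sums of the geometric series for `p⁻¹ ρ`.
  have step : ∀ τ : State A, ∃ τ' : State A,
      ∀ a, Θ.pair a τ' = Θ.pair a ρ + (1 - p) * Θ.pair a τ := by
    intro τ
    obtain ⟨τ₁, hτ⟩ := h.exists_complement τ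
    obtain ⟨K, hK⟩ := h.exists_complement (𝟙 A)
    have key := h.causality.2 (𝟙_ Sys) A A Bool (fun _ => Bool) _
      (fun b => cond b (fun b' : Bool => cond b' (𝟙 A) K) (fun b' => u ≫ cond b' τ τ₁))
      hr (by
        rintro (_ | _)
        · exact h.comp_mem hτ hu
        · exact hK)
    obtain ⟨τ', hτ'⟩ := h.exists_sum_filter key (fun z => z.2 = true)
    refine ⟨τ', fun a => ?_⟩
    have hq : 1 - p = Θ.pair u ρ' := by linarith
    rw [pair_eq_vec, hτ', Finset.sum_filter, Fintype.sum_sigma, hq]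
    have : Θ.pair a (ρ' ≫ u ≫ τ) = Θ.pair u ρ' * Θ.pair a τ := by
      simp only [pair, ← prob_comp, Category.assoc]
    simp [vec_simpleCtx, this]
  choose next hnext using step
  let τ : ℕ → State A := fun n => n.rec ρ fun _ t => next t
  have hτ : ∀ n a, Θ.pair a (τ n) = p⁻¹ * (1 - (1 - p) ^ (n + 1)) * Θ.pair a ρ := by
    intro n a
    induction n with
    | zero => simp [τ, hρ.ne']
    | succ n ih =>
      have : Θ.pair a (τ (n + 1)) = Θ.pair a ρ + (1 - p) * Θ.pair a (τ n) := hnext _ _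
      rw [this, ih]
      field_simp
      ring
  refine h.exists_limit τ (fun a => p⁻¹ * Θ.pair a ρ) ?_ fun a => ?_
  · exact (Θ.StateR A).smul_mem p⁻¹ (pair_mem_stateR ρ)
  · simp only [hτ]
    have : Tendsto (fun n : ℕ => p⁻¹ * (1 - (1 - p) ^ (n + 1)) * Θ.pair a ρ) atTop
        (𝓝 (p⁻¹ * (1 - 0) * Θ.pair a ρ)) :=
      ((((tendsto_pow_atTop_nhds_zero_of_lt_one (by linarith) (by linarith)).comp
        (tendsto_add_atTop_nat 1)).const_sub 1).const_mul _).mul_const _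
    simpa using this

theorem Principles.eq_zero_of_pair_eq_zero (h : Θ.Principles) {A : Sys} {u : Effect A}
    (hu : Θ.IsDeterministic u) {ρ : State A} (hρ : Θ.pair u ρ = 0) (a : Effect A) :
    Θ.pair a ρ = 0 :=
  le_antisymm (hρ ▸ h.pair_le hu a ρ) (pair_nonneg a ρ)

/-- The factor `c` may exceed one: normalize `ρ` and then scale by `c * Θ.pair u ρ`, which is at
most one. -/
theorem Principles.exists_cone_smul (h : Θ.Principles) {A : Sys} {u : Effect A}
    (hu : Θ.IsDeterministic u) (ρ : State A) {c : ℝ} (hc : 0 ≤ c) (hcρ : c * Θ.pair u ρ ≤ 1) :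
    ∃ σ : State A, ∀ a, Θ.pair a σ = c * Θ.pair a ρ := by
  rcases (pair_nonneg (Θ := Θ) u ρ).eq_or_lt with h0 | h0
  · exact ⟨ρ, fun a => by rw [h.eq_zero_of_pair_eq_zero hu h0.symm, mul_zero]⟩
  · obtain ⟨σ, hσ⟩ := h.exists_normalization hu ρ h0
    obtain ⟨τ, hτ⟩ := h.exists_smul (mul_nonneg hc h0.le) hcρ σ
    refine ⟨τ, fun a => ?_⟩
    rw [pair_eq_vec, hτ, ← pair_eq_vec, hσ]
    field_simp

theorem Principles.exists_cone_add (h : Θ.Principles) {A : Sys} {u : Effect A}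
    (hu : Θ.IsDeterministic u) (ρ σ : State A) (hle : Θ.pair u ρ + Θ.pair u σ ≤ 1) :
    ∃ τ : State A, ∀ a, Θ.pair a τ = Θ.pair a ρ + Θ.pair a σ := by
  obtain ⟨τ, hτ⟩ := h.exists_mix (p := 1 / 2) (by norm_num) (by norm_num) ρ σ
  have hτ' : ∀ a, Θ.pair a τ = 1 / 2 * Θ.pair a ρ + 1 / 2 * Θ.pair a σ := fun a => by
    rw [pair_eq_vec, hτ, ← pair_eq_vec, ← pair_eq_vec]; ring
  obtain ⟨υ, hυ⟩ := h.exists_cone_smul hu τ (c := 2) (by norm_num) (by rw [hτ']; linarith)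
  exact ⟨υ, fun a => by rw [hυ, hτ']; ring⟩

theorem Principles.exists_cone_combination (h : Θ.Principles) {A : Sys} {u : Effect A}
    (hu : Θ.IsDeterministic u) {ρ σ : State A} {c d : ℝ} (hc : 0 ≤ c) (hd : 0 ≤ d)
    (hle : c * Θ.pair u ρ + d * Θ.pair u σ ≤ 1) :
    ∃ τ : State A, ∀ a, Θ.pair a τ = c * Θ.pair a ρ + d * Θ.pair a σ := by
  have h1 := mul_nonneg hc (pair_nonneg (Θ := Θ) u ρ)
  have h2 := mul_nonneg hd (pair_nonneg (Θ := Θ) u σ)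
  obtain ⟨ρ', hρ⟩ := h.exists_cone_smul hu ρ hc (by linarith)
  obtain ⟨σ', hσ⟩ := h.exists_cone_smul hu σ hd (by linarith)
  obtain ⟨τ, hτ⟩ := h.exists_cone_add hu ρ' σ' (by rw [hρ, hσ]; exact hle)
  exact ⟨τ, fun a => by rw [hτ, hρ, hσ]⟩

/-- The state `ρ₀` serves only to provide the zero state for an empty sum. -/
theorem Principles.exists_cone_sum (h : Θ.Principles) {A : Sys} {u : Effect A}
    (hu : Θ.IsDeterministic u) (ρ₀ : State A) {ι : Type*} (s : Finset ι) (ρ : ι → State A)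
    (c : ι → ℝ) (hc : ∀ i ∈ s, 0 ≤ c i) (hle : ∑ i ∈ s, c i * Θ.pair u (ρ i) ≤ 1) :
    ∃ τ : State A, ∀ a, Θ.pair a τ = ∑ i ∈ s, c i * Θ.pair a (ρ i) := by
  classical
  induction s using Finset.induction_on with
  | empty =>
    obtain ⟨τ, hτ⟩ := h.exists_cone_smul hu ρ₀ (c := 0) le_rfl (by simp)
    exact ⟨τ, fun a => by simp [hτ]⟩
  | insert i s hi ih =>
    rw [Finset.sum_insert hi] at hle
    have h1 := mul_nonneg (hc i (Finset.mem_insert_self i s)) (pair_nonneg (Θ := Θ) u (ρ i))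
    obtain ⟨σ, hσ⟩ := ih (fun j hj => hc j (Finset.mem_insert_of_mem hj)) (by linarith)
    obtain ⟨τ, hτ⟩ := h.exists_cone_combination hu (ρ := ρ i) (σ := σ) (d := 1)
      (hc i (Finset.mem_insert_self i s)) zero_le_one (by rw [hσ]; linarith)
    exact ⟨τ, fun a => by rw [hτ, hσ, Finset.sum_insert hi, one_mul]⟩

/-! ### Ensembles -/

/-- Every probability distribution is the distribution of a test of scalars. -/
theorem Principles.exists_distribution (h : Θ.Principles) (X : Type) [Finite X] :
    ∀ [Fintype X] (p : X → ℝ), (∀ x, 0 ≤ p x) → ∑ x, p x = 1 →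
      ∃ s ∈ Θ.Tests (𝟙_ Sys) (𝟙_ Sys) X, ∀ x, Θ.Prob (s x) = p x := by
  classical
  induction X using Finite.induction_empty_option with
  | of_equiv e ih =>
    intro _ p hp hs
    have := Fintype.ofEquiv _ e.symm
    obtain ⟨s, h1, h2⟩ := ih (fun x => p (e x)) (fun x => hp _)
      (by rw [← hs]; exact Fintype.sum_equiv e _ _ fun _ => rfl)
    exact ⟨_, h.mem_reindex h1 e, fun y => by simp [h2]⟩
  | h_empty => intro _ p hp hs; simp at hs
  | @h_option X _ ih =>
    intro hX p hp hs
    obtain rfl : hX = instFintypeOption := Subsingleton.elim _ _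
    rw [Fintype.sum_option] at hs
    have hq : 0 ≤ ∑ x, p (some x) := Finset.sum_nonneg fun x _ => hp _
    obtain ⟨s₀, hs₀⟩ := h.exists_scalar (hp none) (by linarith)
    obtain ⟨s₁, hs₁⟩ := h.exists_complement s₀
    have hsum : Θ.Prob s₀ + Θ.Prob s₁ = 1 := by simpa using Θ.consistency Bool _ hs₁
    rcases hq.eq_or_lt with h0 | h0
    · have hz : ∀ x, p (some x) = 0 := fun x =>
        (Finset.sum_eq_zero_iff_of_nonneg fun x _ => hp _).1 h0.symm x (Finset.mem_univ x)
      -- A vanishing remaining mass cannot be renormalized. The test is then a coarse-graining of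
      -- the identity scalar along the constant map to `none`, with zero scalars on the empty
      -- fibres.
      obtain ⟨t, ht⟩ := h.exists_scalar (p := 0) le_rfl zero_le_one
      refine ⟨fun x => Option.casesOn x s₀ fun _ => t, ?_, ?_⟩
      · refine h.mem_of_coarse (h.isDeterministic_iff.1 (isDeterministic_id _))
          (fun _ => none) _ fun x => ?_
        rcases x with _ | x
        · ext c
          simp [vec_state, pair_scalar, hs₀, prob_id]
          rw [show p none = 1 by linarith, one_mul]
        · ext c
          simp [vec_state, pair_scalar, ht]
      · rintro (_ | x)
        · exact hs₀
        · simp [ht, hz]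
    -- Otherwise decide first between `none` and the rest, and in the second case draw from the
    -- renormalized distribution.
    · obtain ⟨s, h1, h2⟩ := ih (fun x => (∑ x, p (some x))⁻¹ * p (some x))
        (fun x => mul_nonneg (inv_nonneg.2 h0.le) (hp _))
        (by rw [← Finset.mul_sum, inv_mul_cancel₀ h0.ne'])
      have key := h.causality.2 (𝟙_ Sys) (𝟙_ Sys) (𝟙_ Sys) Bool (fun b => cond b Unit X) _
        (fun b => match b with
          | true => fun _ => 𝟙 _
          | false => s) hs₁ (by
            rintro (_ | _)
            · exact h1
            · exact h.isDeterministic_iff.1 (isDeterministic_id _))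
      let e : (Σ b : Bool, cond b Unit X) ≃ Option X :=
        { toFun := fun z => match z with
            | ⟨true, _⟩ => none
            | ⟨false, x⟩ => some x
          invFun := fun o => match o with
            | none => ⟨true, ()⟩
            | some x => ⟨false, x⟩
          left_inv := by rintro ⟨_ | _, _⟩ <;> rfl
          right_inv := by rintro (_ | _) <;> rfl }
      refine ⟨_, h.mem_reindex key e, ?_⟩
      rintro (_ | x)
      · simp [e, hs₀]
      · simp only [e, Equiv.coe_fn_symm_mk, cond_false, prob_comp, h2]
        have : Θ.Prob s₁ = ∑ x, p (some x) := by linarith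
        rw [this, mul_inv_cancel_left₀ h0.ne']

/-- States with total probability one form a preparation-test. -/
theorem Principles.ensemble_mem (h : Θ.Principles) {A : Sys} {u : Effect A}
    (hu : Θ.IsDeterministic u) {X : Type} [Fintype X] (ρ : X → State A)
    (hρ : ∑ x, Θ.pair u (ρ x) = 1) : ρ ∈ Θ.Tests (𝟙_ Sys) A X := by
  classical
  obtain ⟨s, hs, hp⟩ := h.exists_distribution X (fun x => Θ.pair u (ρ x))
    (fun x => pair_nonneg _ _) hρ
  have hne : Nonempty X := by
    by_contra hX
    rw [not_nonempty_iff] at hX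
    simp at hρ
  obtain ⟨ρ₀, hρ₀⟩ := h.exists_det_state (ρ hne.some)
  have hnorm : ∀ x, ∃ σ : State A, Θ.IsDeterministic σ ∧
      ∀ a, Θ.pair a (ρ x) = Θ.pair u (ρ x) * Θ.pair a σ := by
    intro x
    rcases (pair_nonneg (Θ := Θ) u (ρ x)).eq_or_lt with h0 | h0
    · exact ⟨ρ₀, hρ₀, fun a => by rw [h.eq_zero_of_pair_eq_zero hu h0.symm, ← h0, zero_mul]⟩
    · obtain ⟨σ, hσ⟩ := h.exists_normalization hu (ρ x) h0
      refine ⟨σ, h.det_of_pair_eq_one hu (by rw [hσ, inv_mul_cancel₀ h0.ne']), fun a => ?_⟩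
      rw [hσ, mul_inv_cancel_left₀ h0.ne']
  choose σ hσ hσρ using hnorm
  -- Draw `x` with probability `Θ.pair u (ρ x)`, then prepare the normalized state `σ x`.
  have key := h.causality.2 _ _ _ X (fun _ => Unit) s (fun x _ => σ x) hs
    fun x => h.isDeterministic_iff.1 (hσ x)
  convert h.mem_reindex key (Equiv.sigmaPUnit X) using 1
  funext x
  refine h.state_ext fun a => ?_
  have : Θ.pair a (s x ≫ σ x) = Θ.Prob (s x) * Θ.pair a (σ x) := by
    simp only [pair, ← prob_comp, Category.assoc]
  simp [hσρ x a, this, hp]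

theorem Principles.isEnsembleOf (h : Θ.Principles) {A : Sys} {u : Effect A}
    (hu : Θ.IsDeterministic u) {X : Type} [Fintype X] (r : X → State A) (ρ : State A)
    (hρ : Θ.pair u ρ = 1) (hr : ∀ a, Θ.pair a ρ = ∑ x, Θ.pair a (r x)) : Θ.IsEnsembleOf r ρ :=
  ⟨h.ensemble_mem hu r (by rw [← hr, hρ]), funext fun c => by simp [vec_state, hr]⟩

theorem IsEnsembleOf.pair_eq {A : Sys} {X : Type} [Fintype X] {r : X → State A} {ρ : State A}
    (hr : Θ.IsEnsembleOf r ρ) (a : Effect A) : Θ.pair a ρ = ∑ x, Θ.pair a (r x) := by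
  rw [pair_eq_vec, hr.2]; simp [pair_eq_vec]

/-! ### Finite-dimensionality and compactness -/

/-- A matrix of finite rank is recovered from finitely many rows and columns. The rows `F (s k)`
form a basis of the row space; by their independence the columns restricted to them span `κ → ℝ`, so
finitely many columns `a i` form a basis there. The coefficients `m` are the inverse of the
resulting square submatrix. -/
theorem exists_frame_of_finiteDimensional {S X : Type v} (F : S → X → ℝ)
    [FiniteDimensional ℝ (Submodule.span ℝ (Set.range F))] :
    ∃ (ι κ : Type v) (_ : Fintype ι) (_ : Fintype κ) (a : ι → X) (s : κ → S) (m : ι → κ → ℝ),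
      ∀ f ∈ Submodule.span ℝ (Set.range F), ∀ x, f x = ∑ i, ∑ k, m i k * f (a i) * F (s k) x := by
  classical
  obtain ⟨κ, s, -, hspan, hli⟩ := exists_linearIndependent' ℝ F
  have hfd : FiniteDimensional ℝ (Submodule.span ℝ (Set.range (F ∘ s))) := by
    rw [hspan]; infer_instance
  have hκ : Finite κ := Module.Finite.finite_basis (Module.Basis.span hli)
  have := Fintype.ofFinite κ
  have hcol := span_flip_eq_top_iff_linearIndependent.2 hli
  obtain ⟨ι, a, -, hspan', hli'⟩ := exists_linearIndependent' ℝ (flip (F ∘ s))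
  rw [hcol] at hspan'
  let b := Module.Basis.mk hli' hspan'.ge
  have hι : Finite ι := Module.Finite.finite_basis b
  have := Fintype.ofFinite ι
  refine ⟨ι, κ, inferInstance, inferInstance, a, s, fun i k => b.repr (Pi.single k 1) i, ?_⟩
  intro f hf x
  rw [← hspan, Submodule.mem_span_range_iff_exists_fun] at hf
  obtain ⟨c, hc⟩ := hf
  let L : (κ → ℝ) →ₗ[ℝ] ℝ := ∑ k, c k • LinearMap.proj k
  have hL : ∀ y, f y = L (flip (F ∘ s) y) := fun y => by
    simp [← hc, L, flip]
  have hcoord : ∀ (y : κ → ℝ) i, b.repr y i = ∑ k, b.repr (Pi.single k 1) i * y k := by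
    intro y i
    have hy : y = ∑ k, y k • Pi.single k (1 : ℝ) := by
      ext j; simp [Finset.sum_apply, Pi.single_apply]
    calc b.repr y i = b.coord i y := rfl
      _ = b.coord i (∑ k, y k • Pi.single k (1 : ℝ)) := by
          rw [← hy]
      _ = _ := by simp [map_sum, mul_comm]
  rw [hL x]
  conv_lhs => rw [← b.sum_repr (flip (F ∘ s) x)]
  rw [map_sum]
  refine Finset.sum_congr rfl fun i _ => ?_
  rw [map_smul, hcoord, smul_eq_mul, Finset.sum_mul]
  refine Finset.sum_congr rfl fun k _ => ?_
  have : L (b i) = f (a i) := by rw [hL]; simp [b]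
  rw [this]
  simp only [flip, Function.comp]
  ring

theorem Principles.exists_frame (h : Θ.Principles) (A : Sys) :
    ∃ (ι κ : Type v) (_ : Fintype ι) (_ : Fintype κ) (a : ι → Effect A) (ρ : κ → State A)
      (m : ι → κ → ℝ),
      ∀ (σ : State A) (c : Effect A),
        Θ.pair c σ = ∑ i, ∑ k, m i k * Θ.pair (a i) σ * Θ.pair c (ρ k) := by
  have : FiniteDimensional ℝ (Θ.StateR A) := h.finiteDim A
  obtain ⟨ι, κ, hι, hκ, a, ρ, m, hm⟩ :=
    @exists_frame_of_finiteDimensional _ _ (fun (ρ : State A) (a : Effect A) => Θ.pair a ρ) this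
  exact ⟨ι, κ, hι, hκ, a, ρ, m, fun σ c => hm _ (pair_mem_stateR σ) c⟩

/-- Sequential compactness of the set of states. -/
theorem Principles.exists_subseq_limit (h : Θ.Principles) {A : Sys} (ρ : ℕ → State A) :
    ∃ (φ : ℕ → ℕ) (σ : State A), StrictMono φ ∧
      ∀ a : Effect A, Tendsto (fun n => Θ.pair a (ρ (φ n))) atTop (𝓝 (Θ.pair a σ)) := by
  obtain ⟨ι, κ, _, _, a, τ, m, hm⟩ := h.exists_frame A
  obtain ⟨x, -, φ, hφ, hx⟩ := (isCompact_univ_pi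
    (fun _ : ι => isCompact_Icc (a := (0 : ℝ)) (b := 1))).tendsto_subseq
    (x := fun n i => Θ.pair (a i) (ρ n)) fun n i _ => ⟨pair_nonneg _ _, pair_le_one _ _⟩
  rw [tendsto_pi_nhds] at hx
  have hlim : ∀ c : Effect A, Tendsto (fun n => Θ.pair c (ρ (φ n))) atTop
      (𝓝 (∑ i, ∑ k, m i k * x i * Θ.pair c (τ k))) := by
    intro c
    refine Tendsto.congr (fun n => (hm (ρ (φ n)) c).symm) ?_
    exact tendsto_finsetSum _ fun i _ => tendsto_finsetSum _ fun k _ =>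
      ((hx i).const_mul _).mul_const _
  obtain ⟨σ, hσ⟩ := h.exists_limit (fun n => ρ (φ n))
    (fun c => ∑ i, ∑ k, m i k * x i * Θ.pair c (τ k)) (by
    have : (fun c : Effect A => ∑ i, ∑ k, m i k * x i * Θ.pair c (τ k)) =
      ∑ i, ∑ k, (m i k * x i) • fun c => Θ.pair c (τ k) := by ext; simp
    rw [this]
    exact Submodule.sum_mem _ fun i _ => Submodule.sum_mem _ fun k _ =>
      Submodule.smul_mem _ _ (pair_mem_stateR _)) hlim
  exact ⟨φ, σ, hφ, fun c => by rw [hσ]; exact hlim c⟩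

/-! ### Extremal events -/

/-- Extremal events: those that span an extreme ray of the cone of events. -/
def RayPure (Θ : OPT Sys) {A B : Sys} (E : A ⟶ B) : Prop :=
  ∀ F G : A ⟶ B, (∀ c, Θ.vec E c = Θ.vec F c + Θ.vec G c) →
    ∃ p : ℝ, ∀ c, Θ.vec F c = p * Θ.vec E c

theorem rayPure_state_iff {A : Sys} {α : State A} : Θ.RayPure α ↔
    ∀ σ τ : State A, (∀ a, Θ.pair a α = Θ.pair a σ + Θ.pair a τ) →
      ∃ p : ℝ, ∀ a, Θ.pair a σ = p * Θ.pair a α := by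
  constructor
  · intro hα σ τ hs
    obtain ⟨p, hp⟩ := hα σ τ fun c => by simp only [vec_state, hs]
    exact ⟨p, fun a => by rw [pair_eq_vec, hp, ← pair_eq_vec]⟩
  · intro hα σ τ hs
    obtain ⟨p, hp⟩ := hα σ τ fun a => by simp only [pair_eq_vec, hs]
    exact ⟨p, fun c => by rw [vec_state, hp, ← vec_state]⟩

theorem pair_eq_vec' {A : Sys} (a : Effect A) (ρ : State A) :
    Θ.pair a ρ = Θ.vec a (simpleCtx ρ (𝟙 _)) := by simp [vec_simpleCtx, pair]

theorem rayPure_effect_iff {A : Sys} {a : Effect A} : Θ.RayPure a ↔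
    ∀ b c : Effect A, (∀ ρ, Θ.pair a ρ = Θ.pair b ρ + Θ.pair c ρ) →
      ∃ p : ℝ, ∀ ρ, Θ.pair b ρ = p * Θ.pair a ρ := by
  constructor
  · intro ha b c hs
    obtain ⟨p, hp⟩ := ha b c fun x => by simp only [vec_effect, hs]
    exact ⟨p, fun a => by rw [pair_eq_vec', hp, ← pair_eq_vec']⟩
  · intro ha b c hs
    obtain ⟨p, hp⟩ := ha b c fun a => by simp only [pair_eq_vec', hs]
    exact ⟨p, fun c => by rw [vec_effect, hp, ← vec_effect]⟩

theorem vec_nonneg {A B : Sys} (T : A ⟶ B) (c : Context A B) : 0 ≤ Θ.vec T c := Θ.prob_nonneg _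

/-- Each refining outcome is a summand of `E`, the other ones adding up to an event, hence it is a
multiple of `E`. Evaluation in a circuit where `E` does not vanish shows that the factors form a
probability distribution. -/
theorem RayPure.isPure (h : Θ.Principles) {A B : Sys} {E : A ⟶ B} (hE : Θ.RayPure E) :
    Θ.IsPure E := by
  classical
  intro X Z _ _ t t' f ht ht' hf x₀ hx₀
  subst hx₀
  have hsum : ∀ c, Θ.vec (t x₀) c = ∑ z with f z = x₀, Θ.vec (t' z) c := fun c => by
    rw [hf x₀]; simp
  by_cases h0 : ∀ c, Θ.vec (t x₀) c = 0
  · have hz : ∀ z, f z = x₀ → ∀ c, Θ.vec (t' z) c = 0 := by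
      intro z hz c
      have := hsum c
      rw [h0 c, eq_comm, Finset.sum_eq_zero_iff_of_nonneg fun z _ => vec_nonneg _ _] at this
      exact this z (by simp [hz])
    by_cases hex : ∃ z, f z = x₀
    · obtain ⟨z₀, hz₀⟩ := hex
      refine ⟨Pi.single z₀ 1, fun z => ?_, fun _ => ?_, fun z hz' => ?_⟩
      · by_cases hzz : z = z₀ <;> simp [hzz]
      · rw [Finset.sum_pi_single']; simp [hz₀]
      · ext c; simp [hz z hz' c, h0 c]
    · exact ⟨fun _ => 0, fun _ => le_rfl, fun hc => absurd hc hex, fun z hz' => absurd ⟨z, hz'⟩ hex⟩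
  · push Not at h0
    obtain ⟨c₀, hc₀⟩ := h0
    have hc₀' : 0 < Θ.vec (t x₀) c₀ := lt_of_le_of_ne (vec_nonneg _ _) (Ne.symm hc₀)
    have key : ∀ z, ∃ p : ℝ, f z = x₀ → ∀ c, Θ.vec (t' z) c = p * Θ.vec (t x₀) c := by
      intro z
      by_cases hz : f z = x₀
      · obtain ⟨G, hG⟩ := h.exists_sum_filter ht' (fun z' => f z' = x₀ ∧ z' ≠ z)
        obtain ⟨p, hp⟩ := hE (t' z) G fun c => by
          rw [hsum, hG, Finset.sum_apply,
            ← Finset.add_sum_erase _ _ (show z ∈ Finset.univ.filter (f · = x₀) by simp [hz])]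
          congr 1
          refine Finset.sum_congr ?_ fun _ _ => rfl
          ext z'; simp [and_comm]
        exact ⟨p, fun _ => hp⟩
      · exact ⟨0, fun hz' => absurd hz' hz⟩
    choose p hp using key
    refine ⟨fun z => if f z = x₀ then p z else 0, fun z => ?_, fun _ => ?_, fun z hz => ?_⟩
    · dsimp only
      split_ifs with hz
      · have := vec_nonneg (Θ := Θ) (t' z) c₀
        rw [hp z hz] at this
        exact nonneg_of_mul_nonneg_left this hc₀'
      · exact le_rfl
    · have h1 := hsum c₀
      rw [Finset.sum_congr rfl fun z hz => hp z (by simpa using hz) c₀, ← Finset.sum_mul] at h1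
      rw [Finset.sum_congr rfl fun z hz => if_pos (by simpa using hz)]
      exact (mul_right_cancel₀ hc₀ (by rw [one_mul]; exact h1)).symm
    · ext c
      simp [hz, hp z hz]

/-- Purity speaks only of tests, so the summands must be completed to one: a state `ρ₁` of the
missing weight `1 - Θ.pair u α` turns `σ, τ, ρ₁` into a test refining `α, ρ₁`. -/
theorem Principles.rayPure_of_isPure_state (h : Θ.Principles) {A : Sys} {u : Effect A}
    (hu : Θ.IsDeterministic u) {α : State A} (hα : Θ.IsPure α) : Θ.RayPure α := by
  classical
  rw [rayPure_state_iff]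
  intro σ τ hs
  obtain ⟨ρ₀, hρ₀⟩ := h.exists_det_state α
  obtain ⟨ρ₁, hρ₁⟩ := h.exists_cone_smul hu ρ₀ (c := 1 - Θ.pair u α)
    (by linarith [pair_le_one (Θ := Θ) u α])
    (by rw [pair_det hu hρ₀]; linarith [pair_nonneg (Θ := Θ) u α])
  have hρ₁u : Θ.pair u ρ₁ = 1 - Θ.pair u α := by rw [hρ₁, pair_det hu hρ₀, mul_one]
  have h1 : (fun b : Bool => cond b α ρ₁) ∈ Θ.Tests _ A Bool :=
    h.ensemble_mem hu _ (by simp [hρ₁u])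
  have h2 : (fun b : Option Bool => b.elim ρ₁ fun b => cond b σ τ) ∈ Θ.Tests _ A (Option Bool) :=
    h.ensemble_mem hu _ (by simp [Fintype.sum_option, hρ₁u, hs])
  obtain ⟨p, -, -, hp⟩ := hα Bool (Option Bool) _ _ (fun b => b.isSome) h1 h2 (by
    intro b
    ext c
    cases b <;> simp [Finset.sum_filter, Fintype.sum_option, vec_state, hs]) true rfl
  refine ⟨p (some true), fun a => ?_⟩
  have := congrFun (hp (some true) rfl) (simpleCtx (𝟙 _) a)
  simpa [← pair_eq_vec] using this

/-! ### Extreme points and invariant states -/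

/-- A strictly convex function on a compact convex set attains its maximum at an extreme point; here
it is the sum of the squared frame coordinates. -/
theorem Principles.exists_pure_state (h : Θ.Principles) {A : Sys} {u : Effect A}
    (hu : Θ.IsDeterministic u) (ρ₀ : State A) : ∃ α : State A, Θ.pair u α = 1 ∧ Θ.RayPure α := by
  obtain ⟨ρ₀, hρ₀⟩ := h.exists_det_state ρ₀
  obtain ⟨ι, κ, _, _, a, r, m, hm⟩ := h.exists_frame A
  let N : State A → ℝ := fun ρ => ∑ i, Θ.pair (a i) ρ ^ 2
  let S : Set ℝ := N '' {ρ | Θ.pair u ρ = 1}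
  have hbdd : BddAbove S := by
    refine ⟨∑ _ : ι, 1, ?_⟩
    rintro _ ⟨ρ, -, rfl⟩
    exact Finset.sum_le_sum fun i _ => pow_le_one₀ (pair_nonneg _ _) (pair_le_one _ _)
  obtain ⟨x, -, hx, hxS⟩ := exists_seq_tendsto_sSup (S := S)
    ⟨_, ρ₀, pair_det hu hρ₀, rfl⟩ hbdd
  choose ρ hρ hρx using hxS
  obtain ⟨φ, α, hφ, hlim⟩ := h.exists_subseq_limit ρ
  have hα : Θ.pair u α = 1 := by
    refine tendsto_nhds_unique (hlim u) ?_
    simp only [show ∀ n, Θ.pair u (ρ n) = 1 from hρ]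
    exact tendsto_const_nhds
  have hNα : N α = sSup S := by
    refine tendsto_nhds_unique (tendsto_finsetSum _ fun i _ => (hlim (a i)).pow 2) ?_
    exact (hx.comp hφ.tendsto_atTop).congr fun n => (hρx (φ n)).symm
  have hmax : ∀ ρ, Θ.pair u ρ = 1 → N ρ ≤ N α := fun ρ hρ => by
    rw [hNα]; exact le_csSup hbdd ⟨ρ, hρ, rfl⟩
  refine ⟨α, hα, rayPure_state_iff.2 fun σ τ hs => ?_⟩
  have hsu := hs u
  rw [hα] at hsu
  rcases (pair_nonneg (Θ := Θ) u σ).eq_or_lt with h0 | h0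
  · exact ⟨0, fun c => by rw [h.eq_zero_of_pair_eq_zero hu h0.symm, zero_mul]⟩
  rcases (pair_nonneg (Θ := Θ) u τ).eq_or_lt with h1 | h1
  · exact ⟨1, fun c => by rw [hs, h.eq_zero_of_pair_eq_zero hu h1.symm, one_mul, add_zero]⟩
  obtain ⟨σ', hσ⟩ := h.exists_normalization hu σ h0
  obtain ⟨τ', hτ⟩ := h.exists_normalization hu τ h1
  set p := Θ.pair u σ
  set q := Θ.pair u τ
  have hσ' : ∀ c, Θ.pair c σ = p * Θ.pair c σ' := fun c => by
    rw [hσ, mul_inv_cancel_left₀ h0.ne']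
  have hτ' : ∀ c, Θ.pair c τ = q * Θ.pair c τ' := fun c => by
    rw [hτ, mul_inv_cancel_left₀ h1.ne']
  have e1 := hmax σ' (by rw [hσ, inv_mul_cancel₀ h0.ne'])
  have e2 := hmax τ' (by rw [hτ, inv_mul_cancel₀ h1.ne'])
  -- The defect in convexity is `p q` times a squared distance, so maximality forces `σ'` and `τ'`
  -- to have the same coordinates.
  have e3 : N α = p * N σ' + q * N τ'
      - p * q * ∑ i, (Θ.pair (a i) σ' - Θ.pair (a i) τ') ^ 2 := by
    simp only [N, Finset.mul_sum]
    rw [← Finset.sum_add_distrib, ← Finset.sum_sub_distrib]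
    refine Finset.sum_congr rfl fun i _ => ?_
    rw [hs, hσ', hτ', show q = 1 - p by linarith]
    ring
  have e4 : ∑ i, (Θ.pair (a i) σ' - Θ.pair (a i) τ') ^ 2 ≤ 0 := by
    have : 0 < p * q := mul_pos h0 h1
    have h5 : p * N σ' + q * N τ' ≤ N α := by
      calc p * N σ' + q * N τ' ≤ p * N α + q * N α := by gcongr
        _ = N α := by rw [← add_mul, ← hsu, one_mul]
    by_contra hc
    push Not at hc
    nlinarith [mul_pos this hc]
  have e5 : ∀ i, Θ.pair (a i) σ' = Θ.pair (a i) τ' := by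
    intro i
    have := (Finset.sum_eq_zero_iff_of_nonneg fun i _ => sq_nonneg _).1
      (le_antisymm e4 (Finset.sum_nonneg fun i _ => sq_nonneg _)) i (Finset.mem_univ i)
    exact sub_eq_zero.1 (pow_eq_zero_iff two_ne_zero |>.1 this)
  have e6 : ∀ c, Θ.pair c σ' = Θ.pair c τ' := fun c => by
    rw [hm σ' c, hm τ' c]; simp only [e5]
  exact ⟨p, fun c => by rw [hs, hσ', hτ', ← e6, ← add_mul, ← hsu, one_mul]⟩

/-- `ε σ` occurs in a decomposition of `ω`, for every state `σ`. -/
def Dominates (Θ : OPT Sys) {A : Sys} (ε : ℝ) (ω : State A) : Prop :=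
  ∀ σ : State A, ∃ G : State A, ∀ c, Θ.pair c ω = ε * Θ.pair c σ + Θ.pair c G

/-- Take for `ω` the normalized sum of the frame states `r k`. The frame coefficients of all states
are bounded by one constant `M`, so subtracting `t⁻¹ M⁻¹ σ` from `ω` leaves non-negative
coefficients. -/
theorem Principles.exists_dominating (h : Θ.Principles) {A : Sys} {u : Effect A}
    (hu : Θ.IsDeterministic u) {ρ₀ : State A} (hρ₀ : Θ.pair u ρ₀ = 1) :
    ∃ (ω : State A) (ε : ℝ), 0 < ε ∧ Θ.pair u ω = 1 ∧ Θ.Dominates ε ω := by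
  obtain ⟨ι, κ, _, _, a, r, m, hm⟩ := h.exists_frame A
  let C : State A → κ → ℝ := fun σ k => ∑ i, m i k * Θ.pair (a i) σ
  have hC : ∀ σ c, Θ.pair c σ = ∑ k, C σ k * Θ.pair c (r k) := fun σ c => by
    rw [hm, Finset.sum_comm]
    exact Finset.sum_congr rfl fun k _ => by rw [Finset.sum_mul]
  let M : ℝ := 1 + ∑ i, ∑ k, |m i k|
  have hM : 1 ≤ M := le_add_of_nonneg_right
    (Finset.sum_nonneg fun i _ => Finset.sum_nonneg fun k _ => abs_nonneg _)
  have hCM : ∀ σ k, C σ k ≤ M := by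
    intro σ k
    calc C σ k ≤ ∑ i, |m i k| := Finset.sum_le_sum fun i _ => by
          calc m i k * Θ.pair (a i) σ ≤ |m i k| * Θ.pair (a i) σ :=
                mul_le_mul_of_nonneg_right (le_abs_self _) (pair_nonneg _ _)
            _ ≤ |m i k| := mul_le_of_le_one_right (abs_nonneg _) (pair_le_one _ _)
      _ ≤ ∑ i, ∑ k, |m i k| := Finset.sum_le_sum fun i _ =>
          Finset.single_le_sum (f := fun k => |m i k|) (fun k _ => abs_nonneg _) (Finset.mem_univ k)
      _ ≤ M := le_add_of_nonneg_left zero_le_one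
  set t := ∑ k, Θ.pair u (r k) with ht
  have ht0 : 0 < t := by
    refine lt_of_le_of_ne (Finset.sum_nonneg fun k _ => pair_nonneg _ _) fun h0 => ?_
    have hz := (Finset.sum_eq_zero_iff_of_nonneg fun k _ => pair_nonneg (Θ := Θ) u (r k)).1
      h0.symm
    rw [hC, Finset.sum_eq_zero fun k hk => by rw [hz k hk, mul_zero]] at hρ₀
    exact zero_ne_one hρ₀
  obtain ⟨ω, hω⟩ := h.exists_cone_sum hu ρ₀ Finset.univ r (fun _ => t⁻¹)
    (fun _ _ => (inv_pos.2 ht0).le) (by rw [← Finset.mul_sum, inv_mul_cancel₀ ht0.ne'])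
  have hM0 : 0 < M := by linarith
  have hωu : Θ.pair u ω = 1 := by rw [hω, ← Finset.mul_sum, inv_mul_cancel₀ ht0.ne']
  refine ⟨ω, t⁻¹ * M⁻¹, by positivity, hωu, fun σ => ?_⟩
  have hsplit : ∀ c, ∑ k, (t⁻¹ - t⁻¹ * M⁻¹ * C σ k) * Θ.pair c (r k) =
      Θ.pair c ω - t⁻¹ * M⁻¹ * Θ.pair c σ := by
    intro c
    rw [hω, hC σ c, Finset.mul_sum, ← Finset.sum_sub_distrib]
    exact Finset.sum_congr rfl fun k _ => by ring
  obtain ⟨G, hG⟩ := h.exists_cone_sum hu ρ₀ Finset.univ r (fun k => t⁻¹ - t⁻¹ * M⁻¹ * C σ k)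
    (fun k _ => by
      have : t⁻¹ * M⁻¹ * C σ k ≤ t⁻¹ * M⁻¹ * M := by
        have := hCM σ k
        gcongr
      rw [inv_mul_cancel_right₀ hM0.ne'] at this
      linarith) (by
      rw [hsplit, hωu]
      have : 0 ≤ t⁻¹ * M⁻¹ * Θ.pair u σ := mul_nonneg (by positivity) (pair_nonneg _ _)
      linarith)
  exact ⟨G, fun c => by rw [hG, hsplit]; ring⟩

theorem Principles.det_comp_iso (h : Θ.Principles) {A B : Sys} {u : Effect A} {u' : Effect B}
    (hu : Θ.IsDeterministic u) (hu' : Θ.IsDeterministic u') (U : A ≅ B) : U.hom ≫ u' = u :=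
  h.det_effect_unique ((isDeterministic_of_iso U).comp hu') hu

/-- There is a dominating state that is invariant under all reversible transformations. -/
theorem Principles.exists_invariant (h : Θ.Principles) {A : Sys} {u : Effect A}
    (hu : Θ.IsDeterministic u) {ρ₀ : State A} (hρ₀ : Θ.pair u ρ₀ = 1) :
    ∃ (χ : State A) (ε : ℝ), 0 < ε ∧ Θ.pair u χ = 1 ∧ Θ.Dominates ε χ ∧
      ∀ U : A ≅ A, χ ≫ U.hom = χ := by
  obtain ⟨ω, ε, hε, hω, hdom⟩ := h.exists_dominating hu hρ₀
  obtain ⟨ι, κ, _, _, a, r, m, hm⟩ := h.exists_frame A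
  let C : Set (State A) := {ρ | Θ.pair u ρ = 1 ∧ Θ.Dominates ε ρ}
  have hinv : ∀ ρ ∈ C, ∀ U : A ≅ A, ρ ≫ U.hom ∈ C := by
    rintro ρ ⟨h1, h2⟩ U
    refine ⟨by rw [pair_comp, h.det_comp_iso hu hu U, h1], fun σ => ?_⟩
    obtain ⟨G, hG⟩ := h2 (σ ≫ U.inv)
    exact ⟨G ≫ U.hom, fun c => by simp only [pair_comp, hG]; simp⟩
  let N : State A → ℝ := fun ρ => ∑ i, Θ.pair (a i) ρ ^ 2
  have hN0 : ∀ ρ, 0 ≤ N ρ := fun ρ => Finset.sum_nonneg fun i _ => sq_nonneg _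
  have hN1 : ∀ ρ, N ρ ≤ ∑ _ : ι, 1 := fun ρ =>
    Finset.sum_le_sum fun i _ => pow_le_one₀ (pair_nonneg _ _) (pair_le_one _ _)
  -- In place of an average over the group, minimize over `C` the supremum of `N` on the orbit.
  -- Strict convexity of `N` forces a minimizer to coincide with its images.
  let f : State A → ℝ := fun ρ => ⨆ U : A ≅ A, N (ρ ≫ U.hom)
  have : Nonempty (A ≅ A) := ⟨Iso.refl A⟩
  have hfb : ∀ ρ, BddAbove (Set.range fun U : A ≅ A => N (ρ ≫ U.hom)) := fun ρ =>
    ⟨∑ _ : ι, 1, by rintro _ ⟨U, rfl⟩; exact hN1 _⟩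
  have hNf : ∀ ρ (U : A ≅ A), N (ρ ≫ U.hom) ≤ f ρ := fun ρ U => le_ciSup (hfb ρ) U
  have hf0 : ∀ ρ, 0 ≤ f ρ := fun ρ => (hN0 _).trans (hNf ρ (Iso.refl A))
  have hbdd : BddBelow (f '' C) := ⟨0, by rintro _ ⟨ρ, -, rfl⟩; exact hf0 ρ⟩
  obtain ⟨x, -, hx, hxS⟩ := exists_seq_tendsto_sInf (S := f '' C) ⟨_, ω, ⟨hω, hdom⟩, rfl⟩ hbdd
  choose ρ hρ hρx using hxS
  obtain ⟨φ, χ, hφ, hlim⟩ := h.exists_subseq_limit ρ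
  set μ := sInf (f '' C)
  have hχC : χ ∈ C := by
    refine ⟨?_, fun σ => ?_⟩
    · refine tendsto_nhds_unique (hlim u) ?_
      simp only [show ∀ n, Θ.pair u (ρ n) = 1 from fun n => (hρ n).1]
      exact tendsto_const_nhds
    · choose G hG using fun n => (hρ n).2 σ
      obtain ⟨ψ, G', hψ, hG'⟩ := h.exists_subseq_limit (fun n => G (φ n))
      refine ⟨G', fun c => tendsto_nhds_unique ((hlim c).comp hψ.tendsto_atTop) ?_⟩
      simp only [Function.comp_def, hG]
      exact (hG' c).const_add _
  have hχμ : ∀ U : A ≅ A, N (χ ≫ U.hom) ≤ μ := by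
    intro U
    refine le_of_tendsto_of_tendsto' (f := fun n => N (ρ (φ n) ≫ U.hom))
      (g := fun n => x (φ n)) ?_ (hx.comp hφ.tendsto_atTop) fun n => ?_
    · simp only [N, pair_comp]
      exact tendsto_finsetSum _ fun i _ => (hlim _).pow 2
    · rw [← hρx]; exact hNf _ U
  refine ⟨χ, ε, hε, hχC.1, hχC.2, fun V => ?_⟩
  set χ' := χ ≫ V.hom with hχ'
  have hχ'C : χ' ∈ C := hinv χ hχC V
  have hχ'μ : ∀ U : A ≅ A, N (χ' ≫ U.hom) ≤ μ := fun U => by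
    have := hχμ (V ≪≫ U)
    simpa [hχ'] using this
  obtain ⟨ν, hν⟩ := h.exists_cone_combination hu (ρ := χ) (σ := χ') (c := 1 / 2) (d := 1 / 2)
    (by norm_num) (by norm_num) (by rw [hχC.1, hχ'C.1]; norm_num)
  have hνC : ν ∈ C := by
    refine ⟨by rw [hν, hχC.1, hχ'C.1]; norm_num, fun σ => ?_⟩
    obtain ⟨G₁, hG₁⟩ := hχC.2 σ
    obtain ⟨G₂, hG₂⟩ := hχ'C.2 σ
    have e1 := pair_le_one (Θ := Θ) u G₁
    have e2 := pair_le_one (Θ := Θ) u G₂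
    obtain ⟨G, hG⟩ := h.exists_cone_combination hu (ρ := G₁) (σ := G₂) (c := 1 / 2) (d := 1 / 2)
      (by norm_num) (by norm_num) (by linarith)
    exact ⟨G, fun c => by rw [hν, hG, hG₁, hG₂]; ring⟩
  have hpar : ∀ U : A ≅ A, N (ν ≫ U.hom) = 1 / 2 * N (χ ≫ U.hom) + 1 / 2 * N (χ' ≫ U.hom)
      - 1 / 4 * ∑ i, (Θ.pair (a i) (χ ≫ U.hom) - Θ.pair (a i) (χ' ≫ U.hom)) ^ 2 := by
    intro U
    simp only [N, Finset.mul_sum]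
    rw [← Finset.sum_add_distrib, ← Finset.sum_sub_distrib]
    refine Finset.sum_congr rfl fun i _ => ?_
    rw [pair_comp, pair_comp, pair_comp, hν]
    ring
  -- Since `f ν` is at least the infimum `μ`, some `U` brings `N (ν ≫ U.hom)` close to `μ`. By
  -- `hpar` this value is at most `μ` minus a quarter of a squared distance, so `U` maps `χ` and
  -- `χ'` to nearby states.
  have hclose : ∀ η : ℝ, 0 < η → ∃ U : A ≅ A, ∀ i,
      |Θ.pair (a i) (χ ≫ U.hom) - Θ.pair (a i) (χ' ≫ U.hom)| < η := by
    intro η hη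
    have h1 : μ ≤ f ν := csInf_le hbdd ⟨ν, hνC, rfl⟩
    obtain ⟨U, hU⟩ := exists_lt_of_lt_ciSup
      (show μ - η ^ 2 / 4 < f ν by have : 0 < η ^ 2 := by positivity
                                   linarith)
    refine ⟨U, fun i => abs_lt_of_sq_lt_sq ?_ hη.le⟩
    have h2 := Finset.single_le_sum (f := fun i =>
      (Θ.pair (a i) (χ ≫ U.hom) - Θ.pair (a i) (χ' ≫ U.hom)) ^ 2) (fun i _ => sq_nonneg _)
      (Finset.mem_univ i)
    have := hpar U
    linarith [hχμ U, hχ'μ U]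
  symm
  refine h.state_ext fun c => ?_
  by_contra hne
  set K : ℝ := ∑ i, ∑ k, |m i k| with hK
  have hK0 : 0 ≤ K := Finset.sum_nonneg fun i _ => Finset.sum_nonneg fun k _ => abs_nonneg _
  have hd : 0 < |Θ.pair c χ - Θ.pair c χ'| := abs_pos.2 (sub_ne_zero.2 hne)
  obtain ⟨U, hU⟩ := hclose (|Θ.pair c χ - Θ.pair c χ'| / (K + 1)) (by positivity)
  -- Closeness after `U` transfers back to `χ` and `χ'` because the constant `K` is the same for all
  -- `U`. A positive distance would be at most `K / (K + 1)` times itself.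
  have hback : ∀ ρ : State A, Θ.pair c ρ = Θ.pair (U.inv ≫ c) (ρ ≫ U.hom) := fun ρ => by
    simp [pair_comp]
  have hbound : |Θ.pair c χ - Θ.pair c χ'| ≤
      K * (|Θ.pair c χ - Θ.pair c χ'| / (K + 1)) := by
    conv_lhs => rw [hback χ, hback χ', hm, hm (χ' ≫ U.hom), ← Finset.sum_sub_distrib]
    rw [hK, Finset.sum_mul]
    refine (Finset.abs_sum_le_sum_abs _ _).trans (Finset.sum_le_sum fun i _ => ?_)
    rw [← Finset.sum_sub_distrib, Finset.sum_mul]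
    refine (Finset.abs_sum_le_sum_abs _ _).trans (Finset.sum_le_sum fun k _ => ?_)
    rw [← sub_mul, ← mul_sub, abs_mul, abs_mul, abs_of_nonneg (pair_nonneg _ (r k))]
    calc |m i k| * _ * Θ.pair (U.inv ≫ c) (r k)
        ≤ |m i k| * |Θ.pair (a i) (χ ≫ U.hom) - Θ.pair (a i) (χ' ≫ U.hom)| :=
          mul_le_of_le_one_right (by positivity) (pair_le_one _ _)
      _ ≤ _ := mul_le_mul_of_nonneg_left (hU i).le (abs_nonneg _)
  rw [← mul_div_assoc, le_div_iff₀ (by positivity)] at hbound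
  nlinarith

/-! ### Local tomography -/

theorem Principles.state_ext_prod (h : Θ.Principles) {A B : Sys} {Ψ Ψ' : State (A ⊗ B)}
    (hΨ : ∀ (a : Effect A) (b : Effect B),
      Θ.pair (prodEff a b) Ψ = Θ.pair (prodEff a b) Ψ') : Ψ = Ψ' :=
  h.localTomography A B Ψ Ψ' hΨ

/-- Events are determined by their action on states. -/
theorem Principles.event_ext_states (h : Θ.Principles) {A B : Sys} {T T' : A ⟶ B}
    (hT : ∀ ρ : State A, ρ ≫ T = ρ ≫ T') : T = T' := by
  refine h.event_ext fun ⟨R, Ψ, m⟩ => ?_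
  have : Ψ ≫ T ▷ R = Ψ ≫ T' ▷ R := h.state_ext_prod fun b r => by
    rw [pair_prodEff_right, pair_prodEff_right, applyRight_whiskerRight, applyRight_whiskerRight,
      hT]
  simp only [vec, reassoc_of% this]

/-- Product states span the states of a composite system. -/
theorem Principles.exists_product_decomposition (h : Θ.Principles) {A B : Sys}
    (Ψ : State (A ⊗ B)) {u : Effect (A ⊗ B)} (hu : Θ.IsDeterministic u) :
    ∃ (J : Type v) (_ : Fintype J) (w : J → ℝ) (ρ : J → State A) (σ : J → State B),
      ∀ E : Effect (A ⊗ B), Θ.pair E Ψ = ∑ j, w j * Θ.pair E (prodState (ρ j) (σ j)) := by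
  obtain ⟨ι, κ, _, _, a, r, m, hm⟩ := h.exists_frame A
  refine ⟨ι × κ, inferInstance, fun j => m j.1 j.2, fun j => r j.2, fun j => applyLeft Ψ (a j.1),
    fun E => ?_⟩
  set P : ι × κ → State (A ⊗ B) := fun j => prodState (r j.2) (applyLeft Ψ (a j.1)) with hP
  -- Local Tomography compares states, not linear combinations. The negative part of the frame
  -- expansion is therefore moved to the side of `Ψ`, and `K⁻¹` scales both sides into genuine
  -- states `s₂` and `s₁`.
  set K : ℝ := 1 + ∑ j : ι × κ, |m j.1 j.2| with hK
  have hK0 : 0 < K := by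
    have : 0 ≤ ∑ j : ι × κ, |m j.1 j.2| := Finset.sum_nonneg fun j _ => abs_nonneg _
    linarith
  have hpos : ∀ j : ι × κ, 0 ≤ K⁻¹ * max (m j.1 j.2) 0 := fun j => by positivity
  have hneg : ∀ j : ι × κ, 0 ≤ K⁻¹ * max (-m j.1 j.2) 0 := fun j => by positivity
  have hbound : ∀ x : ι × κ → ℝ, (∀ j, x j ≤ |m j.1 j.2|) → (∀ j, 0 ≤ x j) →
      K⁻¹ * 1 * Θ.pair u Ψ + ∑ j, K⁻¹ * x j * Θ.pair u (P j) ≤ 1 := by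
    intro x hx hx0
    calc K⁻¹ * 1 * Θ.pair u Ψ + ∑ j, K⁻¹ * x j * Θ.pair u (P j)
        ≤ K⁻¹ * 1 * 1 + ∑ j : ι × κ, K⁻¹ * |m j.1 j.2| * 1 := by
          gcongr with j
          · exact pair_le_one _ _
          · exact pair_nonneg _ _
          · exact hx j
          · exact pair_le_one _ _
      _ = K⁻¹ * K := by rw [hK, mul_add, Finset.mul_sum]; simp
      _ = 1 := inv_mul_cancel₀ hK0.ne'
  have b1 := hbound (fun j => max (m j.1 j.2) 0)
    (fun j => max_le (le_abs_self _) (abs_nonneg _)) (fun j => le_max_right _ _)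
  have b2 := hbound (fun j => max (-m j.1 j.2) 0)
    (fun j => max_le (neg_le_abs _) (abs_nonneg _)) (fun j => le_max_right _ _)
  have hΨ0 : 0 ≤ K⁻¹ * 1 * Θ.pair u Ψ := mul_nonneg (by positivity) (pair_nonneg _ _)
  obtain ⟨s₁, hs₁⟩ := h.exists_cone_sum hu Ψ Finset.univ P _ (fun j _ => hpos j) (by linarith)
  obtain ⟨s₀, hs₀⟩ := h.exists_cone_sum hu Ψ Finset.univ P _ (fun j _ => hneg j) (by linarith)
  obtain ⟨s₂, hs₂⟩ := h.exists_cone_combination hu (ρ := Ψ) (σ := s₀) (c := K⁻¹ * 1) (d := 1)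
    (by positivity) zero_le_one (by rw [hs₀, one_mul]; exact b2)
  have hrel : ∀ E : Effect (A ⊗ B), Θ.pair E s₂ - Θ.pair E s₁ =
      K⁻¹ * (Θ.pair E Ψ - ∑ j, m j.1 j.2 * Θ.pair E (P j)) := by
    intro E
    have hsum : ∑ j, K⁻¹ * max (-m j.1 j.2) 0 * Θ.pair E (P j) -
        ∑ j, K⁻¹ * max (m j.1 j.2) 0 * Θ.pair E (P j) =
        -(K⁻¹ * ∑ j, m j.1 j.2 * Θ.pair E (P j)) := by
      rw [Finset.mul_sum, ← Finset.sum_neg_distrib, ← Finset.sum_sub_distrib]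
      refine Finset.sum_congr rfl fun j _ => ?_
      rcases le_total 0 (m j.1 j.2) with h0 | h0
      · rw [max_eq_left h0, max_eq_right (neg_nonpos.2 h0)]; ring
      · rw [max_eq_right h0, max_eq_left (neg_nonneg.2 h0)]; ring
    rw [hs₂, hs₀, hs₁]
    linarith
  have heq : s₂ = s₁ := h.state_ext_prod fun a' b => by
    refine sub_eq_zero.1 ?_
    rw [hrel, pair_prodEff_right, hm, Fintype.sum_prod_type, sub_eq_zero.2, mul_zero]
    refine Finset.sum_congr rfl fun i _ => Finset.sum_congr rfl fun k _ => ?_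
    rw [hP, pair_prodEff_prodState, ← pair_prodEff_right, pair_prodEff_left]
    ring
  have := hrel E
  rw [heq, sub_self, eq_comm, mul_eq_zero, sub_eq_zero] at this
  exact this.resolve_left (inv_ne_zero hK0.ne')

/-- Events on a composite system are determined by their action on product states. -/
theorem Principles.event_ext_prodStates (h : Θ.Principles) {A B C : Sys} {T T' : A ⊗ B ⟶ C}
    (hT : ∀ (ρ : State A) (σ : State B), prodState ρ σ ≫ T = prodState ρ σ ≫ T') : T = T' := by
  refine h.event_ext_states fun Ψ => h.state_ext fun c => ?_
  obtain ⟨u, hu⟩ := h.exists_det_effect (T ≫ c)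
  obtain ⟨J, _, w, ρ, σ, hw⟩ := h.exists_product_decomposition Ψ hu
  rw [pair_comp, pair_comp, hw, hw]
  simp only [← pair_comp, hT]

theorem Principles.state_smul_ext (h : Θ.Principles) {A B : Sys} {Ψ Ψ' : State (A ⊗ B)} {q : ℝ}
    (h0 : 0 ≤ q) (h1 : q ≤ 1)
    (hΨ : ∀ (a : Effect A) (b : Effect B),
      Θ.pair (prodEff a b) Ψ = q * Θ.pair (prodEff a b) Ψ') (E : Effect (A ⊗ B)) :
    Θ.pair E Ψ = q * Θ.pair E Ψ' := by
  obtain ⟨Φ, hΦ⟩ := h.exists_smul h0 h1 Ψ'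
  have hΦ' : ∀ E, Θ.pair E Φ = q * Θ.pair E Ψ' := fun E => by
    rw [pair_eq_vec, hΦ, ← pair_eq_vec]
  rw [← hΦ', h.state_ext_prod (Ψ := Ψ) (Ψ' := Φ) fun a b => by rw [hΨ, hΦ']]

/-! ### Extremal events and composition -/

theorem vec_comp_right {A B C : Sys} (F : A ⟶ B) (V : B ⟶ C) (c : Context A C) :
    Θ.vec (F ≫ V) c = Θ.vec F ⟨c.1, c.2.1, V ▷ c.1 ≫ c.2.2⟩ := by
  simp [vec]

theorem vec_comp_left {A B C : Sys} (V : A ⟶ B) (F : B ⟶ C) (c : Context A C) :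
    Θ.vec (V ≫ F) c = Θ.vec F ⟨c.1, c.2.1 ≫ V ▷ c.1, c.2.2⟩ := by
  simp [vec]

theorem RayPure.comp_iso {A B C : Sys} {E : A ⟶ B} (hE : Θ.RayPure E) (U : B ≅ C) :
    Θ.RayPure (E ≫ U.hom) := by
  intro F G hFG
  obtain ⟨p, hp⟩ := hE (F ≫ U.inv) (G ≫ U.inv) fun c => by
    rw [vec_comp_right, vec_comp_right, ← hFG, ← vec_comp_right]; simp
  refine ⟨p, fun c => ?_⟩
  rw [vec_comp_right, ← hp, ← vec_comp_right]; simp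

theorem RayPure.iso_comp {A B C : Sys} {E : B ⟶ C} (hE : Θ.RayPure E) (U : A ≅ B) :
    Θ.RayPure (U.hom ≫ E) := by
  intro F G hFG
  obtain ⟨p, hp⟩ := hE (U.inv ≫ F) (U.inv ≫ G) fun c => by
    rw [vec_comp_left, vec_comp_left, ← hFG, ← vec_comp_left]; simp
  refine ⟨p, fun c => ?_⟩
  rw [vec_comp_left, ← hp, ← vec_comp_left]; simp

theorem Principles.rayPure_state_smul (h : Θ.Principles) {A : Sys} {u : Effect A}
    (hu : Θ.IsDeterministic u) {α F G : State A} (hα : Θ.RayPure α) {p : ℝ}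
    (hs : ∀ a, p * Θ.pair a α = Θ.pair a F + Θ.pair a G) :
    ∃ q : ℝ, ∀ a, Θ.pair a F = q * Θ.pair a α := by
  rcases le_or_gt p 0 with hp | hp
  · refine ⟨0, fun a => ?_⟩
    have := mul_nonpos_of_nonpos_of_nonneg hp (pair_nonneg (Θ := Θ) a α)
    linarith [hs a, pair_nonneg (Θ := Θ) a F, pair_nonneg (Θ := Θ) a G]
  · have hle : p⁻¹ * Θ.pair u F + p⁻¹ * Θ.pair u G ≤ 1 := by
      rw [← mul_add, ← hs, inv_mul_cancel_left₀ hp.ne']; exact pair_le_one _ _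
    have hp' := inv_pos.2 hp
    have e1 := mul_nonneg hp'.le (pair_nonneg (Θ := Θ) u F)
    have e2 := mul_nonneg hp'.le (pair_nonneg (Θ := Θ) u G)
    obtain ⟨F', hF⟩ := h.exists_cone_smul hu F hp'.le (by linarith)
    obtain ⟨G', hG⟩ := h.exists_cone_smul hu G hp'.le (by linarith)
    obtain ⟨q, hq⟩ := rayPure_state_iff.1 hα F' G' fun a => by
      rw [hF, hG, ← mul_add, ← hs, inv_mul_cancel_left₀ hp.ne']
    refine ⟨p * q, fun a => ?_⟩
    rw [mul_assoc, ← hq, hF, mul_inv_cancel_left₀ hp.ne']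

theorem pair_applyRight_add {A B : Sys} {b b₁ b₂ : Effect B}
    (hb : ∀ ρ, Θ.pair b ρ = Θ.pair b₁ ρ + Θ.pair b₂ ρ) (Ψ : State (A ⊗ B)) (a : Effect A) :
    Θ.pair a (applyRight Ψ b) =
      Θ.pair a (applyRight Ψ b₁) + Θ.pair a (applyRight Ψ b₂) := by
  simp only [← pair_prodEff_right, pair_prodEff_left, hb]

theorem pair_applyLeft_add {A B : Sys} {a a₁ a₂ : Effect A}
    (ha : ∀ ρ, Θ.pair a ρ = Θ.pair a₁ ρ + Θ.pair a₂ ρ) (Ψ : State (A ⊗ B)) (b : Effect B) :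
    Θ.pair b (applyLeft Ψ a) =
      Θ.pair b (applyLeft Ψ a₁) + Θ.pair b (applyLeft Ψ a₂) := by
  simp only [← pair_prodEff_left, pair_prodEff_right, ha]

/-- A bipartite state with an extremal marginal is a product. -/
theorem Principles.pair_prodEff_of_pure_marginal (h : Θ.Principles) {A B : Sys} {uA : Effect A}
    {uB : Effect B} (huA : Θ.IsDeterministic uA) (huB : Θ.IsDeterministic uB) {α : State A}
    (hα : Θ.RayPure α) (hα1 : Θ.pair uA α = 1) {Γ : State (A ⊗ B)} {p : ℝ}
    (hΓ : ∀ a, Θ.pair a (applyRight Γ uB) = p * Θ.pair a α) (a : Effect A) (b : Effect B) :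
    Θ.pair (prodEff a b) Γ = Θ.pair a α * Θ.pair b (applyLeft Γ uA) := by
  obtain ⟨b', -, hb'⟩ := h.exists_compl_effect huB b
  -- The effects `b` and `b'` steer to summands of the multiple `p α` of `α`, hence to multiples of
  -- `α`.
  obtain ⟨q, hq⟩ := h.rayPure_state_smul huA hα (p := p) (F := applyRight Γ b)
    (G := applyRight Γ b') fun a => by rw [← hΓ, pair_applyRight_add hb']
  have hq' : q = Θ.pair b (applyLeft Γ uA) := by
    rw [← pair_prodEff_left, pair_prodEff_right, hq, hα1, mul_one]
  rw [pair_prodEff_right, hq, hq', mul_comm]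

theorem applyLeft_prodState_pair {A B : Sys} (ρ : State A) (σ : State B) (a : Effect A)
    (b : Effect B) : Θ.pair b (applyLeft (prodState ρ σ) a) = Θ.pair a ρ * Θ.pair b σ := by
  rw [← pair_prodEff_left, pair_prodEff_prodState]

/-- The marginals of a summand of `α ⊗ β` are multiples of `α` and `β`, and an extremal marginal
makes the summand a product. -/
theorem Principles.rayPure_prodState (h : Θ.Principles) {A B : Sys} {uA : Effect A}
    {uB : Effect B} (huA : Θ.IsDeterministic uA) (huB : Θ.IsDeterministic uB) {α : State A}
    {β : State B} (hα : Θ.RayPure α) (hβ : Θ.RayPure β) (hα1 : Θ.pair uA α = 1)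
    (hβ1 : Θ.pair uB β = 1) : Θ.RayPure (prodState α β) := by
  rw [rayPure_state_iff]
  intro Γ₁ Γ₂ hs
  obtain ⟨p, hp⟩ := rayPure_state_iff.1 hα (applyRight Γ₁ uB) (applyRight Γ₂ uB) fun a => by
    rw [← pair_prodEff_right, ← pair_prodEff_right, ← hs, pair_prodEff_prodState, hβ1, mul_one]
  obtain ⟨q, hq⟩ := rayPure_state_iff.1 hβ (applyLeft Γ₁ uA) (applyLeft Γ₂ uA) fun b => by
    rw [← pair_prodEff_left, ← pair_prodEff_left, ← hs, pair_prodEff_prodState, hα1, one_mul]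
  have hq' : q = Θ.pair uB (applyLeft Γ₁ uA) := by rw [hq, hβ1, mul_one]
  refine ⟨q, h.state_smul_ext (hq' ▸ pair_nonneg _ _) (hq' ▸ pair_le_one _ _) fun a b => ?_⟩
  rw [h.pair_prodEff_of_pure_marginal huA huB hα hα1 hp, hq, pair_prodEff_prodState]
  ring

/-! ### Steering -/

theorem associator_prodEff {A B C : Sys} (a : Effect A) (b : Effect B) (c : Effect C) :
    (α_ A B C).hom ≫ prodEff a (prodEff b c) = prodEff (prodEff a b) c := by
  simp only [prodEff, MonoidalCategory.tensorHom_def, comp_whiskerRight,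
    MonoidalCategory.whiskerLeft_comp, Category.assoc]
  rw [← associator_naturality_left_assoc, ← associator_naturality_middle_assoc,
    ← associator_naturality_right_assoc, leftUnitor_naturality]
  simp

theorem braiding_prodEff {A B : Sys} (a : Effect A) (b : Effect B) :
    (β_ A B).hom ≫ prodEff b a = prodEff a b := by
  simp only [prodEff]
  rw [← BraidedCategory.braiding_naturality_assoc, braiding_leftUnitor, unitors_equal]

/-- Preparing the state `φ` on an additional system. -/
def adjoin {K : Sys} (B : Sys) (φ : State K) : B ⟶ B ⊗ K := (ρ_ B).inv ≫ B ◁ φ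

theorem whiskerLeft_adjoin {A B K : Sys} (Ψ : State (A ⊗ B)) (φ : State K) :
    Ψ ≫ A ◁ adjoin B φ = prodState Ψ φ ≫ (α_ A B K).hom := by
  simp only [adjoin, prodState, MonoidalCategory.tensorHom_def, Category.assoc,
    unitors_inv_equal]
  rw [← rightUnitor_inv_naturality_assoc]
  simp

theorem Principles.prodEff_right_mem (h : Θ.Principles) {A B : Sys} {X : Type} {a : Effect A}
    (ha : Θ.IsDeterministic a) {m : X → Effect B} (hm : m ∈ Θ.Tests B (𝟙_ Sys) X) :
    (fun x => prodEff a (m x)) ∈ Θ.Tests (A ⊗ B) (𝟙_ Sys) X := by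
  have := h.comp_mem (h.mem_comp (h.whiskerLeft_mem (𝟙_ Sys) hm)
    (isDeterministic_of_iso (λ_ (𝟙_ Sys)))) (ha.whiskerRight (C := B))
  simpa [prodEff, MonoidalCategory.tensorHom_def] using this

theorem Principles.prodEff_left_mem (h : Θ.Principles) {A B : Sys} {X : Type} {m : X → Effect A}
    {b : Effect B} (hm : m ∈ Θ.Tests A (𝟙_ Sys) X) (hb : Θ.IsDeterministic b) :
    (fun x => prodEff (m x) b) ∈ Θ.Tests (A ⊗ B) (𝟙_ Sys) X := by
  have := h.comp_mem (h.prodEff_right_mem hb hm) (isDeterministic_of_iso (β_ A B))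
  simpa [braiding_prodEff] using this

open Classical in
/-- Some system has perfectly distinguishable normalized states labelled by `X`. -/
def HasFlags (Θ : OPT Sys) (X : Type) : Prop :=
  ∃ (R : Sys) (s : X → State R) (m : X → Effect R), m ∈ Θ.Tests R (𝟙_ Sys) X ∧
    (∀ x, Θ.IsDeterministic (s x)) ∧ ∀ x x', Θ.pair (m x) (s x') = if x = x' then 1 else 0

theorem Principles.hasFlags_bool (h : Θ.Principles) {A : Sys} {ρ ρ' : State A}
    (hd : Θ.PerfectlyDistinguishable ![ρ, ρ']) : Θ.HasFlags Bool := by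
  obtain ⟨m, hm, h1, h2⟩ := hd
  obtain ⟨u, hu⟩ := h.exists_det_effect (m 0)
  refine ⟨A, fun b => ![ρ, ρ'] (finTwoEquiv.symm b), _, h.mem_reindex hm finTwoEquiv,
    fun b => h.det_of_pair_eq_one hu (le_antisymm (pair_le_one _ _) ?_), fun b b' => ?_⟩
  · rw [← h1 (finTwoEquiv.symm b)]
    exact h.pair_le hu _ _
  · split_ifs with hb
    · subst hb; exact h1 _
    · exact h2 _ _ fun e => hb (finTwoEquiv.symm.injective e)

theorem HasFlags.prod (h : Θ.Principles) {X Y : Type} (hX : Θ.HasFlags X) (hY : Θ.HasFlags Y) :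
    Θ.HasFlags (X × Y) := by
  obtain ⟨R, s, m, hm, hs, hms⟩ := hX
  obtain ⟨R', s', m', hm', hs', hms'⟩ := hY
  refine ⟨R ⊗ R', fun z => prodState (s z.1) (s' z.2), fun z => prodEff (m z.1) (m' z.2),
    h.mem_comp (Θ.par_mem hm hm') (isDeterministic_of_iso _), fun z => (hs _).prodState (hs' _),
    fun z z' => ?_⟩
  rw [pair_prodEff_prodState, hms, hms']
  by_cases h1 : z.1 = z'.1 <;> by_cases h2 : z.2 = z'.2 <;> simp [Prod.ext_iff, h1, h2]

/-- If no two states are perfectly distinguishable, all systems have a single normalized state. -/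
theorem Principles.eq_of_not_hasFlags (h : Θ.Principles) (hF : ¬ Θ.HasFlags Bool) {A : Sys}
    {u : Effect A} (hu : Θ.IsDeterministic u) {ρ σ : State A} (hρ : Θ.pair u ρ = 1)
    (hσ : Θ.pair u σ = 1) : ρ = σ := by
  obtain ⟨α, hα, hα'⟩ := h.exists_pure_state hu ρ
  -- Without distinguishable states even the extremal state `α` must be internal; all states are
  -- then summands of `α` up to a factor, hence multiples of it.
  have hint : Θ.IsInternal α := by
    by_contra hc
    obtain ⟨α', hd⟩ := h.perfectStateDiscrimination A α ((h.isNormalizedState_iff hu).2 hα) hc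
    exact hF (h.hasFlags_bool hd)
  have key : ∀ τ : State A, Θ.pair u τ = 1 → τ = α := by
    intro τ hτ
    obtain ⟨l, F, G, hl, hF, hG, -⟩ := hint τ
    have hF' : ∀ a, Θ.pair a F = l * Θ.pair a τ := fun a => by
      rw [pair_eq_vec, hF, pair_eq_vec]; simp
    have hG' : ∀ a, Θ.pair a α = Θ.pair a F + Θ.pair a G := fun a => by
      rw [hF', pair_eq_vec, hG, pair_eq_vec, pair_eq_vec]; simp
    obtain ⟨p, hp⟩ := rayPure_state_iff.1 hα' F G hG'
    have hlp : l = p := by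
      have := hp u
      rwa [hF', hτ, hα, mul_one, mul_one] at this
    refine h.state_ext fun a => ?_
    have := hp a
    rw [hF', ← hlp] at this
    exact mul_left_cancel₀ hl.ne' this
  rw [key ρ hρ, key σ hσ]

/-- Attach the flag `s x` to `r x` and purify the sum over `x`. The result `Φ` and `Ψ` purify the
same state of `A`; adjoining pure states `β` and `φ` gives both the purifying system `B ⊗ (R ⊗ C)`,
and a reversible `U` relates them. Reading the flag in the second purification selects `r x`. -/
theorem Principles.steering_of_hasFlags (h : Θ.Principles) {X : Type} [Fintype X]
    (hX : Θ.HasFlags X) {A B : Sys} {uA : Effect A} {uB : Effect B}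
    (huA : Θ.IsDeterministic uA) (huB : Θ.IsDeterministic uB) {Ψ : State (A ⊗ B)}
    (hΨ : Θ.RayPure Ψ) (hΨ1 : Θ.pair (prodEff uA uB) Ψ = 1) (r : X → State A)
    (hr : ∀ a, Θ.pair a (applyRight Ψ uB) = ∑ x, Θ.pair a (r x)) :
    ∃ b ∈ Θ.Tests B (𝟙_ Sys) X, ∀ x, applyRight Ψ (b x) = r x := by
  classical
  obtain ⟨R, s, m, hm, hs, hms⟩ := hX
  have hne : Nonempty X := by
    by_contra hX
    rw [not_nonempty_iff] at hX
    rw [pair_prodEff_right, hr] at hΨ1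
    simp at hΨ1
  obtain ⟨uR, huR⟩ := h.exists_det_effect (m hne.some)
  obtain ⟨σ, hσ⟩ := h.exists_cone_sum (huA.prodEff huR) (prodState (r hne.some) (s hne.some))
    Finset.univ (fun x => prodState (r x) (s x)) (fun _ => 1) (fun _ _ => zero_le_one) (by
      simp only [pair_prodEff_prodState, one_mul, pair_det huR (hs _), mul_one]
      rw [← hr, ← pair_prodEff_right, hΨ1])
  obtain ⟨C, Φ, e, hΦ, he, hΦσ⟩ := (h.purification (A ⊗ R) σ).1
  have huK := huR.prodEff he
  set uK := prodEff uR e with huK'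
  set Φ₁ : State (A ⊗ (R ⊗ C)) := Φ ≫ (α_ A R C).hom with hΦ₁
  have hΦ₁p : Θ.RayPure Φ₁ :=
    (h.rayPure_of_isPure_state ((huA.prodEff huR).prodEff he) hΦ).comp_iso _
  have hΦ₁e : ∀ a c, Θ.pair (prodEff a (prodEff c e)) Φ₁ =
      ∑ x, Θ.pair a (r x) * Θ.pair c (s x) := by
    intro a c
    rw [hΦ₁, pair_comp, associator_prodEff, pair_prodEff_right, hΦσ, hσ]
    simp [pair_prodEff_prodState]
  have hΦ₁u : ∀ a, Θ.pair (prodEff a uK) Φ₁ = Θ.pair (prodEff a uB) Ψ := by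
    intro a
    rw [huK', hΦ₁e, pair_prodEff_right, hr]
    simp [pair_det huR (hs _)]
  obtain ⟨φ, hφ1, hφ⟩ := h.exists_pure_state huK (applyLeft Φ₁ uA)
  obtain ⟨β, hβ1, hβ⟩ := h.exists_pure_state huB (applyLeft Ψ uA)
  have huAB := huA.prodEff huB
  have huBK := huB.prodEff huK
  set Θ₁ : State (A ⊗ (B ⊗ (R ⊗ C))) := prodState Ψ φ ≫ (α_ A B (R ⊗ C)).hom with hΘ₁
  set Θ₂ : State (A ⊗ (B ⊗ (R ⊗ C))) :=
    (prodState Φ₁ β ≫ (α_ A (R ⊗ C) B).hom) ≫ A ◁ (β_ (R ⊗ C) B).hom with hΘ₂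
  have hΘ₁p : Θ.RayPure Θ₁ := (h.rayPure_prodState huAB huK hΨ hφ hΨ1 hφ1).comp_iso _
  have hΘ₂p : Θ.RayPure Θ₂ :=
    ((h.rayPure_prodState (huA.prodEff huK) huB hΦ₁p hβ (by rw [hΦ₁u, hΨ1]) hβ1).comp_iso
      _).comp_iso (whiskerLeftIso A (β_ (R ⊗ C) B))
  have hΘ₁v : ∀ a b k, Θ.pair a (applyRight Θ₁ (prodEff b k)) =
      Θ.pair (prodEff a b) Ψ * Θ.pair k φ := by
    intro a b k
    rw [← pair_prodEff_right, hΘ₁, pair_comp, associator_prodEff, pair_prodEff_prodState]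
  have hΘ₂v : ∀ a b k, Θ.pair a (applyRight Θ₂ (prodEff b k)) =
      Θ.pair (prodEff a k) Φ₁ * Θ.pair b β := by
    intro a b k
    rw [hΘ₂, applyRight_whiskerLeft, braiding_prodEff, ← pair_prodEff_right, pair_comp,
      associator_prodEff, pair_prodEff_prodState]
  obtain ⟨U, hU, hUu⟩ := (h.purification A (applyRight Ψ uB)).2 (B ⊗ (R ⊗ C)) Θ₁ Θ₂
    (prodEff uB uK) (prodEff uB uK)
    ⟨hΘ₁p.isPure h, huBK, h.state_ext fun a => by
      rw [hΘ₁v, hφ1, mul_one, pair_prodEff_right]⟩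
    ⟨hΘ₂p.isPure h, huBK, h.state_ext fun a => by
      rw [hΘ₂v, hβ1, mul_one, hΦ₁u, pair_prodEff_right]⟩
  have hφd : Θ.IsDeterministic (adjoin B φ) :=
    (isDeterministic_of_iso (ρ_ B).symm).comp (h.det_of_pair_eq_one huK hφ1).whiskerLeft
  -- The measurement on `B`: adjoin `φ`, apply `U`, read the flag on `R` and discard the rest.
  refine ⟨_, h.comp_mem (h.prodEff_right_mem huB (h.prodEff_left_mem hm he))
    (hφd.comp (isDeterministic_of_iso U)), fun x => h.state_ext fun a => ?_⟩
  rw [Category.assoc, ← applyRight_whiskerLeft, whiskerLeft_adjoin, ← hΘ₁,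
    ← applyRight_whiskerLeft, ← hU, hΘ₂v, hβ1, mul_one, hΦ₁e]
  simp [hms]

/-- Steering: every ensemble of a marginal of a pure state is induced by a measurement. -/
theorem Principles.steering (h : Θ.Principles) {A B : Sys} {uA : Effect A} {uB : Effect B}
    (huA : Θ.IsDeterministic uA) (huB : Θ.IsDeterministic uB) {Ψ : State (A ⊗ B)}
    (hΨ : Θ.RayPure Ψ) (hΨ1 : Θ.pair (prodEff uA uB) Ψ = 1) (r : Bool × Bool → State A)
    (hr : ∀ a, Θ.pair a (applyRight Ψ uB) = ∑ x, Θ.pair a (r x)) :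
    ∃ b ∈ Θ.Tests B (𝟙_ Sys) (Bool × Bool), ∀ x, applyRight Ψ (b x) = r x := by
  -- Two copies of a two-valued flag label four outcomes, as many as are needed below.
  by_cases hF : Θ.HasFlags Bool
  · exact h.steering_of_hasFlags (hF.prod h hF) huA huB hΨ hΨ1 r hr
  · rw [pair_prodEff_right] at hΨ1
    -- Without flags `A` has a single normalized state, so an ensemble is a mere distribution:
    -- discard `B` and draw `x` at random.
    obtain ⟨s, hs, hsp⟩ := h.exists_distribution (Bool × Bool) (fun x => Θ.pair uA (r x))
      (fun x => pair_nonneg _ _) (by rw [← hr, hΨ1])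
    refine ⟨_, h.comp_mem hs huB, fun x => h.state_ext fun a => ?_⟩
    have h1 : Θ.pair a (applyRight Ψ (uB ≫ s x)) =
        Θ.pair a (applyRight Ψ uB) * Θ.pair uA (r x) := by
      rw [← pair_prodEff_right, ← pair_prodEff_right, pair_prodEff_left, pair_prodEff_left, ← hsp]
      simp only [pair, ← prob_comp, Category.assoc]
    rw [h1]
    rcases (pair_nonneg (Θ := Θ) uA (r x)).eq_or_lt with h0 | h0
    · rw [← h0, mul_zero, h.eq_zero_of_pair_eq_zero huA h0.symm]
    · obtain ⟨σ, hσ⟩ := h.exists_normalization huA (r x) h0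
      rw [← h.eq_of_not_hasFlags hF huA (ρ := σ) (σ := applyRight Ψ uB)
        (by rw [hσ, inv_mul_cancel₀ h0.ne']) hΨ1, hσ]
      field_simp

/-! ### Faithful bipartite states -/

/-- Every state occurs, up to a positive factor, in a decomposition of `ω`. -/
def Internal (Θ : OPT Sys) {A : Sys} (ω : State A) : Prop :=
  ∀ σ : State A, ∃ l : ℝ, 0 < l ∧ ∃ G : State A, ∀ a, Θ.pair a ω = l * Θ.pair a σ + Θ.pair a G

/-- A normalized bipartite state with internal marginals, such that all ensembles of each marginal
are induced by measurements on the other system. -/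
structure Faithful (Θ : OPT Sys) {A B : Sys} (uA : Effect A) (uB : Effect B)
    (Ψ : State (A ⊗ B)) : Prop where
  norm : Θ.pair (prodEff uA uB) Ψ = 1
  internal_left : Θ.Internal (applyRight Ψ uB)
  internal_right : Θ.Internal (applyLeft Ψ uA)
  steer_left : ∀ r : Bool × Bool → State A,
    (∀ a, Θ.pair a (applyRight Ψ uB) = ∑ x, Θ.pair a (r x)) →
      ∃ b ∈ Θ.Tests B (𝟙_ Sys) (Bool × Bool), ∀ x, applyRight Ψ (b x) = r x
  steer_right : ∀ r : Bool × Bool → State B,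
    (∀ b, Θ.pair b (applyLeft Ψ uA) = ∑ x, Θ.pair b (r x)) →
      ∃ a ∈ Θ.Tests A (𝟙_ Sys) (Bool × Bool), ∀ x, applyLeft Ψ (a x) = r x

theorem Faithful.symm {A B : Sys} {uA : Effect A} {uB : Effect B} {Ψ : State (A ⊗ B)}
    (hΨ : Θ.Faithful uA uB Ψ) : Θ.Faithful uB uA (Ψ ≫ (β_ A B).hom) where
  norm := by rw [pair_comp, braiding_prodEff]; exact hΨ.norm
  internal_left := by rw [applyRight_braiding]; exact hΨ.internal_right
  internal_right := by rw [applyLeft_braiding]; exact hΨ.internal_left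
  steer_left := by simp only [applyRight_braiding]; exact hΨ.steer_right
  steer_right := by simp only [applyLeft_braiding]; exact hΨ.steer_left

/-- Ideal compression, with a decoding that works for all ensembles simultaneously. -/
theorem Principles.exists_compression (h : Θ.Principles) {A : Sys} {u : Effect A}
    (hu : Θ.IsDeterministic u) {ω : State A} (hω : Θ.IsDeterministic ω) :
    ∃ (B : Sys) (E : A ⟶ B) (D : B ⟶ A), Θ.IsDeterministic E ∧ Θ.IsDeterministic D ∧
      (∀ ρ G : State A, (∀ a, Θ.pair a ω = Θ.pair a ρ + Θ.pair a G) → ρ ≫ E ≫ D = ρ) ∧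
      (∀ σ : State B, σ ≫ D ≫ E = σ) ∧ Θ.Internal (ω ≫ E) := by
  classical
  obtain ⟨B, E, hE, hloss, hmax⟩ := h.idealCompression A ω hω
  -- Losslessness provides one decoding per ensemble. A finite family spanning all summands of `ω`
  -- is placed in a single ensemble; its decoding fixes the span, hence every summand.
  let S := {ρ : State A // ∃ G : State A, ∀ a, Θ.pair a ω = Θ.pair a ρ + Θ.pair a G}
  let F : S → Effect A → ℝ := fun ρ a => Θ.pair a ρ.1
  have hfd : FiniteDimensional ℝ (Submodule.span ℝ (Set.range F)) := by
    have := h.finiteDim A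
    have hle : Submodule.span ℝ (Set.range F) ≤ Θ.StateR A :=
      Submodule.span_le.2 (by rintro _ ⟨ρ, rfl⟩; exact pair_mem_stateR ρ.1)
    exact Submodule.finiteDimensional_of_le hle
  obtain ⟨κ, s, -, hspan, hli⟩ := exists_linearIndependent' ℝ F
  have hfd' : FiniteDimensional ℝ (Submodule.span ℝ (Set.range (F ∘ s))) := by
    rw [hspan]; exact hfd
  have hκ : Finite κ := Module.Finite.finite_basis (Module.Basis.span hli)
  have := Fintype.ofFinite κ
  obtain ⟨O, hO⟩ := h.exists_smul (p := 0) le_rfl zero_le_one ω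
  have hO' : ∀ a, Θ.pair a O = 0 := fun a => by rw [pair_eq_vec, hO, zero_mul]
  let e := Fintype.equivFin κ
  let t : Option (Fin (Fintype.card κ)) → S := fun j =>
    j.elim ⟨ω, O, fun a => by rw [hO', add_zero]⟩ fun j => s (e.symm j)
  choose G hG using fun j => (t j).2
  -- Each index contributes a pair of states with sum `ω`, and there are `card κ + 1` indices,
  -- `none` included; weighted by `c`, they form an ensemble of `ω`.
  let c : ℝ := ((Fintype.card κ : ℝ) + 1)⁻¹
  have hc0 : 0 < c := by positivity
  have hc1 : c ≤ 1 := inv_le_one_of_one_le₀ (by simp)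
  choose sc hsc using fun ρ : State A => h.exists_smul hc0.le hc1 ρ
  have hsc' : ∀ ρ a, Θ.pair a (sc ρ) = c * Θ.pair a ρ := fun ρ a => by
    rw [pair_eq_vec, hsc, ← pair_eq_vec]
  obtain ⟨D, hD, hDr⟩ := hloss (Option (Fin (Fintype.card κ)) × Bool)
    (fun x => cond x.2 (sc (t x.1).1) (sc (G x.1)))
    (h.isEnsembleOf hu _ _ (pair_det hu hω) fun a => by
      rw [Fintype.sum_prod_type]
      simp only [Fintype.sum_bool, cond_true, cond_false, hsc', ← mul_add, ← hG]
      simp [c]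
      field_simp)
  have hfix : ∀ k b, Θ.pair (E ≫ D ≫ b) (s k).1 = Θ.pair b (s k).1 := by
    intro k b
    have h1 : sc (s k).1 ≫ E ≫ D = sc (s k).1 := by
      have := hDr (some (e k), true)
      simpa [t] using this
    have h2 : Θ.pair b (sc (s k).1 ≫ E ≫ D) = Θ.pair b (sc (s k).1) := by rw [h1]
    rw [pair_comp, Category.assoc, hsc', hsc'] at h2
    exact mul_left_cancel₀ hc0.ne' h2
  have hfixS : ∀ ρ G : State A, (∀ a, Θ.pair a ω = Θ.pair a ρ + Θ.pair a G) → ρ ≫ E ≫ D = ρ := by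
    intro ρ G hρ
    have hmem : F ⟨ρ, G, hρ⟩ ∈ Submodule.span ℝ (Set.range (F ∘ s)) := by
      rw [hspan]; exact Submodule.subset_span ⟨_, rfl⟩
    obtain ⟨w, hw⟩ := (Submodule.mem_span_range_iff_exists_fun ℝ).1 hmem
    have hw' : ∀ a, Θ.pair a ρ = ∑ k, w k * Θ.pair a (s k).1 := fun a => by
      have := congrFun hw a
      simp only [Finset.sum_apply, Pi.smul_apply, smul_eq_mul, F, Function.comp] at this
      exact this.symm
    refine h.state_ext fun b => ?_
    rw [pair_comp, Category.assoc, hw', hw' b]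
    simp only [hfix]
  have hens : ∀ {X : Type} [Fintype X] (r : X → State A), Θ.IsEnsembleOf r ω → ∀ x,
      ∃ G : State A, ∀ a, Θ.pair a ω = Θ.pair a (r x) + Θ.pair a G := by
    intro X _ r hr x
    obtain ⟨G, hG⟩ := h.exists_sum_filter hr.1 (fun y => y ≠ x)
    refine ⟨G, fun a => ?_⟩
    rw [hr.pair_eq, pair_eq_vec a G, hG, Finset.sum_apply,
      ← Finset.add_sum_erase _ _ (Finset.mem_univ x)]
    congr 1
    exact Finset.sum_congr (by ext; simp) fun y _ => pair_eq_vec _ _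
  refine ⟨B, E, D, hE, hD, hfixS, fun σ => ?_, fun σ => ?_⟩
  · obtain ⟨X, _, r, x, l, hr, hl, hσ⟩ := hmax σ
    obtain ⟨G, hG⟩ := hens r hr x
    have hσ' : ∀ b, Θ.pair b σ = l * Θ.pair b (r x ≫ E) := fun b => by
      rw [pair_eq_vec, hσ, pair_eq_vec]; rfl
    refine h.state_ext fun b => ?_
    have hx : r x ≫ E ≫ D ≫ E = r x ≫ E := by
      have := hfixS _ _ hG
      rw [← Category.assoc E D E, ← Category.assoc, this]
    rw [pair_comp, hσ', hσ' b, ← pair_comp, Category.assoc, hx]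
  · obtain ⟨X, _, r, x, l, hr, hl, hσ⟩ := hmax σ
    have hσ' : ∀ b, Θ.pair b σ = l * Θ.pair b (r x ≫ E) := fun b => by
      rw [pair_eq_vec, hσ, pair_eq_vec]; rfl
    rcases hl.eq_or_lt with h0 | h0
    · exact ⟨1, one_pos, ω ≫ E, fun b => by rw [hσ', ← h0]; ring⟩
    · obtain ⟨G, hG⟩ := hens r hr x
      refine ⟨l⁻¹, inv_pos.2 h0, G ≫ E, fun b => ?_⟩
      rw [hσ', inv_mul_cancel_left₀ h0.ne', pair_comp, pair_comp, pair_comp, hG]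

/-- A purification of `ω` already allows steering, but its marginal on the purifying system need not
be internal. Ideal Compression replaces that system by one where it is; the decoding transports the
steering measurements. -/
theorem Principles.exists_faithful (h : Θ.Principles) {A : Sys} {uA : Effect A}
    (huA : Θ.IsDeterministic uA) {ω : State A} (hω1 : Θ.pair uA ω = 1) (hω : Θ.Internal ω) :
    ∃ (B : Sys) (uB : Effect B) (Ψ : State (A ⊗ B)), Θ.IsDeterministic uB ∧
      Θ.Faithful uA uB Ψ ∧ applyRight Ψ uB = ω := by
  obtain ⟨B₀, Ψ₀, e, hΨ₀, he, rfl⟩ := (h.purification A ω).1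
  have hΨ₀p := h.rayPure_of_isPure_state (huA.prodEff he) hΨ₀
  have hnorm : Θ.pair (prodEff uA e) Ψ₀ = 1 := by rw [pair_prodEff_right, hω1]
  obtain ⟨B, E, D, hE, hD, hfix, hDE, hint⟩ := h.exists_compression he (ω := applyLeft Ψ₀ uA)
    (h.det_of_pair_eq_one he (by rw [← pair_prodEff_left, hnorm]))
  have hu : Θ.IsDeterministic (D ≫ e) := hD.comp he
  have hEu : E ≫ D ≫ e = e := h.det_effect_unique (hE.comp hu) he
  -- All states steered by effects of `A` are summands of the compressed marginal, hence survive
  -- encoding and decoding; Local Tomography extends this to `Ψ₀`.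
  have hΨfix : Ψ₀ ≫ A ◁ (E ≫ D) = Ψ₀ := h.state_ext_prod fun a b => by
    obtain ⟨a', -, ha'⟩ := h.exists_compl_effect huA a
    rw [pair_prodEff_left, applyLeft_whiskerLeft,
      hfix _ (applyLeft Ψ₀ a') fun b => pair_applyLeft_add ha' Ψ₀ b, pair_prodEff_left]
  have hmarg : applyRight (Ψ₀ ≫ A ◁ E) (D ≫ e) = applyRight Ψ₀ e := by
    rw [applyRight_whiskerLeft, hEu]
  refine ⟨B, D ≫ e, Ψ₀ ≫ A ◁ E, hu, ⟨?_, ?_, ?_, ?_, ?_⟩, hmarg⟩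
  · rw [pair_prodEff_right, hmarg, hω1]
  · rwa [hmarg]
  · rwa [applyLeft_whiskerLeft]
  · intro r hr
    rw [hmarg] at hr
    obtain ⟨b, hb, hbr⟩ := h.steering huA he hΨ₀p hnorm r hr
    refine ⟨_, h.comp_mem hb hD, fun x => ?_⟩
    rw [applyRight_whiskerLeft, ← Category.assoc, ← applyRight_whiskerLeft, hΨfix, hbr]
  · intro r hr
    have hr' : ∀ b, Θ.pair b (applyLeft Ψ₀ uA) = ∑ x, Θ.pair b (r x ≫ D) := fun b => by
      rw [← hΨfix, applyLeft_whiskerLeft, ← Category.assoc, pair_comp,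
        ← applyLeft_whiskerLeft, hr]
      simp only [pair_comp]
    obtain ⟨a, ha, har⟩ := h.steering he huA (Ψ := Ψ₀ ≫ (β_ A B₀).hom) (hΨ₀p.comp_iso _)
      (by rw [pair_comp, braiding_prodEff, hnorm]) (fun x => r x ≫ D)
      (by simpa only [applyRight_braiding] using hr')
    refine ⟨a, ha, fun x => ?_⟩
    rw [applyLeft_whiskerLeft, ← applyRight_braiding, har, Category.assoc, hDE]

theorem Principles.exists_zero (h : Θ.Principles) {A B : Sys} (T : A ⟶ B) :
    ∃ O : A ⟶ B, ∀ c, Θ.vec O c = 0 := by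
  obtain ⟨O, hO⟩ := h.exists_smul (p := 0) le_rfl zero_le_one T
  exact ⟨O, fun c => by rw [hO, zero_mul]⟩

/-- Zero states pad the decomposition to the four outcomes of the steering property. -/
theorem Faithful.exists_effect_right (h : Θ.Principles) {A B : Sys} {uA : Effect A}
    {uB : Effect B} {Ψ : State (A ⊗ B)} (hΨ : Θ.Faithful uA uB Ψ) {σ τ : State A}
    (hs : ∀ a, Θ.pair a (applyRight Ψ uB) = Θ.pair a σ + Θ.pair a τ) :
    ∃ b : Effect B, applyRight Ψ b = σ := by
  obtain ⟨O, hO⟩ := h.exists_zero σ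
  obtain ⟨b, -, hb⟩ := hΨ.steer_left
    (fun x => cond x.1 (cond x.2 σ τ) O) fun a => by
      simp [Fintype.sum_prod_type, hs, pair_eq_vec a O, hO]
  exact ⟨b (true, true), hb _⟩

theorem Faithful.exists_effect_left (h : Θ.Principles) {A B : Sys} {uA : Effect A}
    {uB : Effect B} {Ψ : State (A ⊗ B)} (hΨ : Θ.Faithful uA uB Ψ) {σ τ : State B}
    (hs : ∀ a, Θ.pair a (applyLeft Ψ uA) = Θ.pair a σ + Θ.pair a τ) :
    ∃ a : Effect A, applyLeft Ψ a = σ := by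
  obtain ⟨a, ha⟩ := hΨ.symm.exists_effect_right h (by rwa [applyRight_braiding])
  exact ⟨a, by rw [← ha, applyRight_braiding]⟩

/-- Effects are determined by the states they steer to. -/
theorem Faithful.pair_eq (h : Θ.Principles) {A B : Sys} {uA : Effect A} {uB : Effect B}
    (huA : Θ.IsDeterministic uA) {Ψ : State (A ⊗ B)} (hΨ : Θ.Faithful uA uB Ψ) {a b : Effect A}
    {q : ℝ} (hab : ∀ c, Θ.pair c (applyLeft Ψ a) = q * Θ.pair c (applyLeft Ψ b)) (ρ : State A) :
    Θ.pair a ρ = q * Θ.pair b ρ := by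
  obtain ⟨l, hl, G, hG⟩ := hΨ.internal_left ρ
  -- A positive multiple `F` of `ρ` is steered by some effect `d` of `B`; the hypothesis evaluated
  -- at `d` is the claim.
  obtain ⟨F, hF⟩ := h.exists_cone_smul huA ρ hl.le (by
    have := hG uA
    rw [← pair_prodEff_right, hΨ.norm] at this
    linarith [pair_nonneg (Θ := Θ) uA G])
  obtain ⟨d, hd⟩ := hΨ.exists_effect_right h (σ := F) (τ := G) fun c => by rw [hG, hF]
  have key := hab d
  rw [← pair_prodEff_left, ← pair_prodEff_left, pair_prodEff_right, pair_prodEff_right, hd, hF,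
    hF, mul_left_comm] at key
  exact mul_left_cancel₀ hl.ne' key

theorem Faithful.effect_ext (h : Θ.Principles) {A B : Sys} {uA : Effect A} {uB : Effect B}
    (huA : Θ.IsDeterministic uA) {Ψ : State (A ⊗ B)} (hΨ : Θ.Faithful uA uB Ψ) {a b : Effect A}
    (hab : applyLeft Ψ a = applyLeft Ψ b) : a = b :=
  h.effect_ext fun ρ => by
    rw [hΨ.pair_eq h huA (a := a) (b := b) (q := 1) (fun c => by rw [hab, one_mul]) ρ, one_mul]

/-- If `a = c + c'`, it is not evident that `c`, `c'` and the complement `a'` occur in one test.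
Steering yields a test producing the states to which they steer, and effects are determined by these
states; so the test consists of `c`, `c'`, `a'` and a zero effect, and purity applies. -/
theorem Faithful.rayPure_of_isPure_effect (h : Θ.Principles) {A B : Sys} {uA : Effect A}
    {uB : Effect B} (huA : Θ.IsDeterministic uA) {Ψ : State (A ⊗ B)}
    (hΨ : Θ.Faithful uA uB Ψ) {a : Effect A} (ha : Θ.IsPure a) : Θ.RayPure a := by
  classical
  rw [rayPure_effect_iff]
  intro c c' hs
  obtain ⟨a', ha', haa'⟩ := h.exists_compl_effect huA a
  obtain ⟨O, hO⟩ := h.exists_zero (applyLeft Ψ a)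
  have hO' : ∀ b, Θ.pair b O = 0 := fun b => by rw [pair_eq_vec, hO]
  obtain ⟨d, hd, hdr⟩ := hΨ.steer_right
    (fun x => cond x.1 (cond x.2 (applyLeft Ψ c) (applyLeft Ψ c'))
      (cond x.2 (applyLeft Ψ a') O)) fun b => by
      simp [Fintype.sum_prod_type, hO', pair_applyLeft_add haa', pair_applyLeft_add hs]
  have d1 : d (true, true) = c := hΨ.effect_ext h huA (hdr _)
  have d2 : d (true, false) = c' := hΨ.effect_ext h huA (hdr _)
  have d3 : d (false, true) = a' := hΨ.effect_ext h huA (hdr _)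
  have d4 : ∀ ρ, Θ.pair (d (false, false)) ρ = 0 := fun ρ => by
    rw [hΨ.pair_eq h huA (a := d (false, false)) (b := a) (q := 0)
      (fun b => by rw [hdr, zero_mul]; exact hO' b) ρ, zero_mul]
  obtain ⟨p, -, -, hp⟩ := ha Bool (Bool × Bool) _ d Prod.fst ha' hd (by
    intro b
    ext x
    cases b <;> simp [Finset.sum_filter, Fintype.sum_prod_type, vec_effect, d1, d2, d3, d4, hs])
    true rfl
  refine ⟨p (true, true), fun ρ => ?_⟩
  have := congrFun (hp (true, true) rfl) (simpleCtx ρ (𝟙 _))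
  rw [d1] at this
  simpa [← pair_eq_vec'] using this

theorem Dominates.internal {A : Sys} {ε : ℝ} {ω : State A} (hε : 0 < ε)
    (hω : Θ.Dominates ε ω) : Θ.Internal ω := fun σ => ⟨ε, hε, hω σ⟩

/-- The state `ρ` only ensures that `A` has states, so that a faithful extension exists. -/
theorem Principles.rayPure_of_isPure_effect (h : Θ.Principles) {A : Sys} (ρ : State A)
    {a : Effect A} (ha : Θ.IsPure a) : Θ.RayPure a := by
  obtain ⟨u, hu⟩ := h.exists_det_effect a
  obtain ⟨ρ₀, hρ₀⟩ := h.exists_det_state ρ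
  obtain ⟨ω, ε, hε, hω, hdom⟩ := h.exists_dominating hu (pair_det hu hρ₀)
  obtain ⟨B, uB, Ψ, -, hΨ, -⟩ := h.exists_faithful hu hω (hdom.internal hε)
  exact hΨ.rayPure_of_isPure_effect h hu ha

/-! ### Extremality of the identity and of local effects -/

/-- The identity is an extremal event. -/
theorem Principles.pair_comp_eq_smul_of_add_eq_id (h : Θ.Principles) {C : Sys} {u : Effect C}
    (hu : Θ.IsDeterministic u) {γ : State C} (hγ : Θ.pair u γ = 1) {T S : C ⟶ C} {μ : ℝ}
    (hs : ∀ c, Θ.vec T c + Θ.vec S c = μ * Θ.vec (𝟙 C) c) :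
    ∃ p : ℝ, ∀ (σ : State C) (c : Effect C), Θ.pair c (σ ≫ T) = p * Θ.pair c σ := by
  obtain ⟨ω, ε, hε, hω, hdom⟩ := h.exists_dominating hu hγ
  obtain ⟨E, Ψ, e, hΨ, he, rfl⟩ := (h.purification C ω).1
  have hΨp := h.rayPure_of_isPure_state (hu.prodEff he) hΨ
  -- Applied to one half of the extremal state `Ψ`, the event `T` gives a summand of `μ Ψ`, hence `p
  -- Ψ`. Steering from the other half carries this over to every state `σ`.
  obtain ⟨p, hp⟩ := h.rayPure_state_smul (hu.prodEff he) hΨp (F := Ψ ≫ T ▷ E)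
    (G := Ψ ≫ S ▷ E) (p := μ) fun m => by
      have := hs ⟨E, Ψ, m⟩
      simp only [vec, id_whiskerRight, Category.id_comp] at this
      simpa [pair] using this.symm
  refine ⟨p, fun σ c => ?_⟩
  obtain ⟨G, hG⟩ := hdom σ
  obtain ⟨F, hF⟩ := h.exists_cone_smul hu σ hε.le (by
    have := hG u
    rw [hω] at this
    linarith [pair_nonneg (Θ := Θ) u G])
  obtain ⟨O, hO⟩ := h.exists_zero σ
  obtain ⟨d, -, hd⟩ := h.steering hu he hΨp (by rw [pair_prodEff_right, hω])
    (fun x => cond x.1 (cond x.2 F G) O) fun a => by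
      simp [Fintype.sum_prod_type, hG, hF, pair_eq_vec a O, hO]
  have hd' : applyRight Ψ (d (true, true)) = F := hd _
  have key := hp (prodEff c (d (true, true)))
  rw [pair_prodEff_right, pair_prodEff_right, applyRight_whiskerRight, hd', pair_comp, hF, hF,
    mul_left_comm] at key
  rw [pair_comp]
  exact mul_left_cancel₀ hε.ne' key

/-- Preparing the state `ρ` on an additional system, to the left. -/
def adjoinLeft {A : Sys} (ρ : State A) (C : Sys) : C ⟶ A ⊗ C := (λ_ C).inv ≫ ρ ▷ C

theorem comp_adjoinLeft {A C : Sys} (ρ : State A) (σ : State C) :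
    σ ≫ adjoinLeft ρ C = prodState ρ σ := by
  simp only [adjoinLeft, prodState, MonoidalCategory.tensorHom_def']
  rw [leftUnitor_inv_naturality_assoc]

theorem comp_adjoin {A C : Sys} (ρ : State A) (σ : State C) :
    ρ ≫ adjoin A σ = prodState ρ σ := by
  simp only [adjoin, prodState, MonoidalCategory.tensorHom_def]
  rw [rightUnitor_inv_naturality_assoc, unitors_inv_equal]

/-- Let `T` be a summand of `a` applied locally. For fixed `ρ`, the event `T (ρ ⊗ ·)` is a summand
of a multiple of the identity, hence a multiple `q` of it. For the fixed state `γ`, discarding the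
output shows that `q` depends on `ρ` as a multiple of `a`. Product states suffice to determine `T`.
-/
theorem Principles.rayPure_whiskerRight (h : Θ.Principles) {A C : Sys} {u : Effect C}
    (hu : Θ.IsDeterministic u) {γ : State C} (hγ : Θ.pair u γ = 1) {a : Effect A}
    (ha : Θ.RayPure a) : Θ.RayPure (a ▷ C ≫ (λ_ C).hom) := by
  intro T S hs
  have hsum : ∀ (Φ : State (A ⊗ C)) (c : Effect C), Θ.pair c (applyLeft Φ a) =
      Θ.pair c (Φ ≫ T) + Θ.pair c (Φ ≫ S) := fun Φ c => by
    have := hs (simpleCtx Φ c)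
    rwa [vec_simpleCtx, vec_simpleCtx, vec_simpleCtx] at this
  have hid : ∀ ρ : State A, ∃ q : ℝ, ∀ (σ : State C) (c : Effect C),
      Θ.pair c (prodState ρ σ ≫ T) = q * Θ.pair c σ := by
    intro ρ
    obtain ⟨q, hq⟩ := h.pair_comp_eq_smul_of_add_eq_id hu hγ (T := adjoinLeft ρ C ≫ T)
      (S := adjoinLeft ρ C ≫ S) (μ := Θ.pair a ρ) fun c => by
        rw [vec_comp_left, vec_comp_left, ← hs, ← vec_comp_left, pair, ← vec_scalar_comp]
        simp [adjoinLeft, scalar]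
    refine ⟨q, fun σ c => ?_⟩
    rw [← comp_adjoinLeft, Category.assoc, hq]
  obtain ⟨p, hp⟩ := rayPure_effect_iff.1 ha (adjoin A γ ≫ T ≫ u) (adjoin A γ ≫ S ≫ u)
    fun ρ => by
      rw [← pair_comp, ← pair_comp, ← pair_comp, ← pair_comp, comp_adjoin, ← hsum,
        applyLeft_prodState_pair, hγ, mul_one]
  have hle : ∀ ρ, p * Θ.pair a ρ ≤ Θ.pair a ρ := fun ρ => by
    rw [← hp, ← pair_comp, ← pair_comp, comp_adjoin]
    have := hsum (prodState ρ γ) u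
    rw [applyLeft_prodState_pair, hγ, mul_one] at this
    linarith [pair_nonneg (Θ := Θ) u (prodState ρ γ ≫ S)]
  -- If `a` vanishes, `p` is arbitrary; a factor in `[0, 1]` is needed for the multiple of the local
  -- effect to be an event.
  obtain ⟨p', h0, h1, hp'⟩ : ∃ p' : ℝ, 0 ≤ p' ∧ p' ≤ 1 ∧
      ∀ ρ, Θ.pair (adjoin A γ ≫ T ≫ u) ρ = p' * Θ.pair a ρ := by
    by_cases hz : ∀ ρ, Θ.pair a ρ = 0
    · exact ⟨0, le_rfl, zero_le_one, fun ρ => by rw [hp, hz]; ring⟩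
    · push Not at hz
      obtain ⟨ρ, hρ⟩ := hz
      have hρ' : 0 < Θ.pair a ρ := lt_of_le_of_ne (pair_nonneg _ _) (Ne.symm hρ)
      refine ⟨p, nonneg_of_mul_nonneg_left (by rw [← hp ρ]; exact pair_nonneg _ _) hρ', ?_, hp⟩
      exact le_of_mul_le_mul_right (by rw [one_mul]; exact hle ρ) hρ'
  obtain ⟨T₀, hT₀⟩ := h.exists_smul h0 h1 (a ▷ C ≫ (λ_ C).hom)
  refine ⟨p', fun c => ?_⟩
  rw [← hT₀]
  congr 1
  refine h.event_ext_prodStates fun ρ σ => h.state_ext fun c => ?_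
  obtain ⟨q, hq⟩ := hid ρ
  have hqp : q = p' * Θ.pair a ρ := by
    rw [← hp', ← pair_comp, ← pair_comp, comp_adjoin, hq, hγ, mul_one]
  rw [hq, hqp, ← vec_simpleCtx, hT₀, vec_simpleCtx]
  have : Θ.pair c (prodState ρ σ ≫ a ▷ C ≫ (λ_ C).hom) = Θ.pair a ρ * Θ.pair c σ :=
    applyLeft_prodState_pair ρ σ a c
  rw [this, mul_assoc]

/-! ### Extremal normalized effects -/

/-- A state on which an extremal effect occurs with certainty is pure. -/
theorem Principles.rayPure_of_pair_eq_one (h : Θ.Principles) {A : Sys} {a : Effect A}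
    (ha : Θ.RayPure a) {ρ : State A} (hρ : Θ.pair a ρ = 1) : Θ.RayPure ρ := by
  obtain ⟨uA, huA⟩ := h.exists_det_effect a
  obtain ⟨C, Φ, e, hΦ, he, rfl⟩ := (h.purification A ρ).1
  have hγ1 : Θ.pair e (applyLeft Φ a) = 1 := by
    rw [← pair_prodEff_left, pair_prodEff_right, hρ]
  -- Purity of Composition, applied to `Φ` and the local effect `a`.
  have hγ : Θ.RayPure (applyLeft Φ a) := h.rayPure_of_isPure_state he
    (h.purityOfComposition _ _ _ _ _ hΦ ((h.rayPure_whiskerRight he hγ1 ha).isPure h))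
  have hΦp := h.rayPure_of_isPure_state (huA.prodEff he) hΦ
  obtain ⟨a', -, ha'⟩ := h.exists_compl_effect huA a
  have hρ1 : Θ.pair uA (applyRight Φ e) = 1 :=
    le_antisymm (pair_le_one _ _) (hρ ▸ h.pair_le huA a _)
  -- As `a` is certain on `ρ`, its complement never occurs, and conditioning on `a` does not change
  -- the marginal.
  have hmarg : applyLeft Φ uA = applyLeft Φ a := h.state_ext fun c => by
    rw [pair_applyLeft_add ha', h.eq_zero_of_pair_eq_zero he (ρ := applyLeft Φ a'), add_zero]
    rw [← pair_prodEff_left, pair_prodEff_right]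
    linarith [ha' (applyRight Φ e)]
  have hprod : Φ = prodState (applyRight Φ e) (applyLeft Φ a) := h.state_ext_prod fun b c => by
    have := h.pair_prodEff_of_pure_marginal he huA hγ hγ1 (Γ := Φ ≫ (β_ A C).hom) (p := 1)
      (fun c => by rw [applyRight_braiding, hmarg, one_mul]) c b
    rw [pair_comp, braiding_prodEff, applyLeft_braiding] at this
    rw [this, pair_prodEff_prodState, mul_comm]
  rw [rayPure_state_iff]
  intro σ τ hs
  set ρ := applyRight Φ e
  set γ := applyLeft Φ a
  -- A decomposition of `ρ` now induces one of the extremal state `Φ`, the product of `ρ` and `γ`.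
  have hadd : ∀ E, Θ.pair E Φ = Θ.pair E (prodState σ γ) + Θ.pair E (prodState τ γ) := by
    intro E
    rw [hprod, ← comp_adjoin, ← comp_adjoin, ← comp_adjoin, pair_comp, pair_comp, pair_comp, hs]
  obtain ⟨p, hp⟩ := rayPure_state_iff.1 hΦp _ _ hadd
  refine ⟨p, fun b => ?_⟩
  have := hp (prodEff b e)
  rwa [pair_prodEff_prodState, hγ1, mul_one, pair_prodEff_right] at this

/-- The midpoint of two states on which `a` is certain is again such a state, hence extremal, so
both states equal it. -/
theorem Principles.eq_of_pair_eq_one (h : Θ.Principles) {A : Sys} {a : Effect A}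
    (ha : Θ.RayPure a) {ρ σ : State A} (hρ : Θ.pair a ρ = 1) (hσ : Θ.pair a σ = 1) : ρ = σ := by
  obtain ⟨u, hu⟩ := h.exists_det_effect a
  have hu1 : ∀ τ, Θ.pair a τ = 1 → Θ.pair u τ = 1 := fun τ hτ =>
    le_antisymm (pair_le_one _ _) (hτ ▸ h.pair_le hu a _)
  have key : ∀ τ τ' : State A, Θ.pair a τ = 1 → Θ.pair a τ' = 1 → ∀ c,
      Θ.pair c τ = 1 / 2 * Θ.pair c τ + 1 / 2 * Θ.pair c τ' := by
    intro τ τ' hτ hτ' c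
    obtain ⟨μ, hμ⟩ := h.exists_cone_combination hu (ρ := τ) (σ := τ') (c := 1 / 2) (d := 1 / 2)
      (by norm_num) (by norm_num) (by rw [hu1 τ hτ, hu1 τ' hτ']; norm_num)
    have hμp : Θ.RayPure μ := h.rayPure_of_pair_eq_one ha (by rw [hμ, hτ, hτ']; norm_num)
    obtain ⟨F, hF⟩ := h.exists_cone_smul hu τ (c := 1 / 2) (by norm_num)
      (by rw [hu1 τ hτ]; norm_num)
    obtain ⟨G, hG⟩ := h.exists_cone_smul hu τ' (c := 1 / 2) (by norm_num)
      (by rw [hu1 τ' hτ']; norm_num)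
    obtain ⟨p, hp⟩ := rayPure_state_iff.1 hμp F G fun b => by rw [hμ, hF, hG]
    have hp' := hp u
    rw [hF, hμ, hu1 τ hτ, hu1 τ' hτ'] at hp'
    have hpc := hp c
    rw [hF, hμ, show p = 1 / 2 by linarith] at hpc
    linarith
  refine h.state_ext fun c => ?_
  linarith [key ρ σ hρ hσ c]

/-- Reversible transformations act transitively on the pure normalized states. -/
theorem Principles.exists_iso_of_rayPure (h : Θ.Principles) {A : Sys} {u : Effect A}
    (hu : Θ.IsDeterministic u) {α β : State A} (hα : Θ.RayPure α) (hβ : Θ.RayPure β)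
    (hα1 : Θ.pair u α = 1) (hβ1 : Θ.pair u β = 1) : ∃ U : A ≅ A, β = α ≫ U.hom := by
  -- The normalized extremal states of `A` are purifications of the trivial state, with `A` as
  -- purifying system.
  have key : ∀ τ : State A, Θ.RayPure τ → Θ.pair u τ = 1 →
      Θ.IsPurification (τ ≫ (λ_ A).inv : State (𝟙_ Sys ⊗ A)) u (𝟙 (𝟙_ Sys)) := by
    intro τ hτ hτ1
    refine ⟨(hτ.comp_iso (λ_ A).symm).isPure h, hu, h.prob_scalar_ext ?_⟩
    rw [prob_id, ← hτ1, pair]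
    simp only [applyRight, Category.assoc]
    rw [← unitors_equal, leftUnitor_naturality, Iso.inv_hom_id_assoc]
  obtain ⟨U, hU, -⟩ := (h.purification (𝟙_ Sys) (𝟙 _)).2 A _ _ u u (key α hα hα1) (key β hβ hβ1)
  refine ⟨U, ?_⟩
  have := congrArg (· ≫ (λ_ A).hom) hU
  simpa using this

/-! ### Extremality under steering and existence of certain effects. -/

theorem Faithful.pair_add_eq (h : Θ.Principles) {A B : Sys} {uA : Effect A} {uB : Effect B}
    (huA : Θ.IsDeterministic uA) {Ψ : State (A ⊗ B)} (hΨ : Θ.Faithful uA uB Ψ)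
    {a b b' : Effect A}
    (hab : ∀ c, Θ.pair c (applyLeft Ψ a) =
      Θ.pair c (applyLeft Ψ b) + Θ.pair c (applyLeft Ψ b')) (ρ : State A) :
    Θ.pair a ρ = Θ.pair b ρ + Θ.pair b' ρ := by
  -- The sum of `b` and `b'` is not known to be an effect, so their half-mixture is used, with
  -- factor `2`.
  obtain ⟨m, hm⟩ := h.exists_mix (p := 1 / 2) (by norm_num) (by norm_num) b b'
  have hm' : ∀ ρ, Θ.pair m ρ = 1 / 2 * Θ.pair b ρ + 1 / 2 * Θ.pair b' ρ := fun ρ => by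
    rw [pair_eq_vec', hm, ← pair_eq_vec', ← pair_eq_vec']; ring
  have := hΨ.pair_eq h huA (a := a) (b := m) (q := 2) (fun c => by
    rw [hab, ← pair_prodEff_left, ← pair_prodEff_left, ← pair_prodEff_left, pair_prodEff_right,
      pair_prodEff_right, pair_prodEff_right, hm']
    ring) ρ
  rw [this, hm']
  ring

/-- A state steered by an extremal effect is extremal. -/
theorem Faithful.rayPure_of_applyLeft (h : Θ.Principles) {A B : Sys} {uA : Effect A}
    {uB : Effect B} (huA : Θ.IsDeterministic uA) (huB : Θ.IsDeterministic uB)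
    {Ψ : State (A ⊗ B)} (hΨ : Θ.Faithful uA uB Ψ) {a : Effect A} (ha : Θ.RayPure a) {q : ℝ}
    (hq : 0 < q) {β : State B} (hβ : ∀ c, Θ.pair c (applyLeft Ψ a) = q * Θ.pair c β)
    (hβ1 : Θ.pair uB β = 1) : Θ.RayPure β := by
  rw [rayPure_state_iff]
  intro σ τ hs
  have hq1 : q ≤ 1 := by
    have := pair_le_one (Θ := Θ) uB (applyLeft Ψ a)
    rwa [hβ, hβ1, mul_one] at this
  obtain ⟨a', -, ha'⟩ := h.exists_compl_effect huA a
  have hsu := hs uB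
  rw [hβ1] at hsu
  -- A summand of `β`, scaled by `q`, is a summand of the marginal and is thus steered by an effect;
  -- a decomposition of `β` becomes one of `a`.
  have scale : ∀ σ τ : State B, (∀ c, Θ.pair c β = Θ.pair c σ + Θ.pair c τ) →
      ∃ c : Effect A, ∀ b, Θ.pair b (applyLeft Ψ c) = q * Θ.pair b σ := by
    intro σ τ hs
    obtain ⟨σ', hσ⟩ := h.exists_cone_smul huB σ hq.le
      (mul_le_one₀ hq1 (pair_nonneg _ _) (pair_le_one _ _))
    obtain ⟨τ', hτ⟩ := h.exists_cone_combination huB (ρ := τ) (σ := applyLeft Ψ a') (c := q)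
      (d := 1) hq.le zero_le_one (by
        have h1 := pair_applyLeft_add ha' Ψ uB
        rw [hβ, hs, ← pair_prodEff_left, hΨ.norm] at h1
        nlinarith [mul_nonneg hq.le (pair_nonneg (Θ := Θ) uB σ)])
    obtain ⟨c, hc⟩ := hΨ.exists_effect_left h (σ := σ') (τ := τ') fun b => by
      rw [pair_applyLeft_add ha', hβ, hs, hσ, hτ]; ring
    exact ⟨c, fun b => by rw [hc, hσ]⟩
  obtain ⟨c, hc⟩ := scale σ τ hs
  obtain ⟨c', hc'⟩ := scale τ σ fun b => by rw [hs, add_comm]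
  obtain ⟨p, hp⟩ := rayPure_effect_iff.1 ha c c' (hΨ.pair_add_eq h huA fun b => by
    rw [hc, hc', hβ, hs, mul_add])
  refine ⟨p, fun b => mul_left_cancel₀ hq.ne' ?_⟩
  rw [← hc, mul_left_comm, ← hβ, ← pair_prodEff_left, ← pair_prodEff_left, pair_prodEff_right,
    pair_prodEff_right, hp]

/-- Let `q` be the largest weight of a pure state `β` in the marginal on `B`, with remainder `G`.
The effect `a` steering to `q β` is extremal. It is certain on any normalized state of `A` steered
by an effect that vanishes on `G`, because the complement of `a` steers to `G`. -/
theorem Faithful.exists_rayPure_effect (h : Θ.Principles) {A B : Sys} {uA : Effect A}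
    {uB : Effect B} (huA : Θ.IsDeterministic uA) (huB : Θ.IsDeterministic uB)
    {Ψ : State (A ⊗ B)} (hΨ : Θ.Faithful uA uB Ψ) :
    ∃ (a : Effect A) (ρ : State A), Θ.RayPure a ∧ Θ.pair a ρ = 1 := by
  obtain ⟨β, hβ1, hβ⟩ := h.exists_pure_state huB (applyLeft Ψ uA)
  have hω1 : Θ.pair uB (applyLeft Ψ uA) = 1 := by rw [← pair_prodEff_left, hΨ.norm]
  let Q : Set ℝ := {q | ∃ G : State B,
    ∀ b, Θ.pair b (applyLeft Ψ uA) = q * Θ.pair b β + Θ.pair b G}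
  have hQ : BddAbove Q := by
    refine ⟨1, ?_⟩
    rintro q ⟨G, hG⟩
    have := hG uB
    rw [hω1, hβ1] at this
    linarith [pair_nonneg (Θ := Θ) uB G]
  obtain ⟨l, hl, G₀, hG₀⟩ := hΨ.internal_right β
  obtain ⟨x, -, hx, hxQ⟩ := exists_seq_tendsto_sSup (S := Q) ⟨l, G₀, hG₀⟩ hQ
  set q := sSup Q
  have hq : 0 < q := hl.trans_le (le_csSup hQ ⟨G₀, hG₀⟩)
  choose Gn hGn using hxQ
  obtain ⟨φ, G, hφ, hG⟩ := h.exists_subseq_limit Gn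
  have hqG : ∀ b, Θ.pair b (applyLeft Ψ uA) = q * Θ.pair b β + Θ.pair b G := fun b =>
    tendsto_nhds_unique (tendsto_const_nhds.congr fun n => hGn (φ n) b)
      (((hx.comp hφ.tendsto_atTop).mul_const _).add (hG b))
  obtain ⟨F, hF⟩ := h.exists_cone_smul huB β hq.le (by
    have := hqG uB
    rw [hω1] at this
    linarith [pair_nonneg (Θ := Θ) uB G])
  obtain ⟨a, ha⟩ := hΨ.exists_effect_left h (σ := F) (τ := G) fun b => by rw [hqG, hF]
  have hap : Θ.RayPure a := by
    rw [rayPure_effect_iff]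
    intro b c hs
    obtain ⟨r, hr⟩ := h.rayPure_state_smul huB hβ (p := q) (F := applyLeft Ψ b)
      (G := applyLeft Ψ c) fun d => by rw [← hF, ← ha, pair_applyLeft_add hs]
    refine ⟨r * q⁻¹, hΨ.pair_eq h huA fun d => ?_⟩
    rw [hr, ha, hF, mul_assoc, inv_mul_cancel_left₀ hq.ne']
  obtain ⟨a', -, ha'⟩ := h.exists_compl_effect huA a
  have hG' : ∀ b, Θ.pair b (applyLeft Ψ a') = Θ.pair b G := fun b => by
    have := pair_applyLeft_add ha' Ψ b
    rw [hqG, ha, hF] at this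
    linarith
  rcases (pair_nonneg (Θ := Θ) uB G).eq_or_lt with h0 | h0
  · refine ⟨a, applyRight Ψ uB, hap, ?_⟩
    rw [← pair_prodEff_right, pair_prodEff_left, ha, hF, ← hω1, hqG, ← h0, add_zero]
  · obtain ⟨σ, hσ⟩ := h.exists_normalization huB G h0
    set g := Θ.pair uB G
    have hσ1 : Θ.pair uB σ = 1 := by rw [hσ, inv_mul_cancel₀ h0.ne']
    have hσG : ∀ b, Θ.pair b G = g * Θ.pair b σ := fun b => by
      rw [hσ, mul_inv_cancel_left₀ h0.ne']
    -- An internal remainder would contain a further portion of `β`, against the maximality of `q`;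
    -- hence Perfect State Discrimination applies to it.
    by_cases hint : Θ.IsInternal σ
    · exfalso
      obtain ⟨l', F', G', hl', -, hG'', -⟩ := hint β
      have hdec : ∀ b, Θ.pair b σ = l' * Θ.pair b β + Θ.pair b G' := fun b => by
        rw [pair_eq_vec, hG'', pair_eq_vec, pair_eq_vec]; rfl
      obtain ⟨G₁, hG₁⟩ := h.exists_cone_smul huB G' h0.le
        (mul_le_one₀ (pair_le_one _ _) (pair_nonneg _ _) (pair_le_one _ _))
      have : q + g * l' ≤ q := le_csSup hQ ⟨G₁, fun b => by rw [hqG, hσG, hdec, hG₁]; ring⟩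
      linarith [mul_pos h0 hl']
    · obtain ⟨ρ', m, hm, h1, h2⟩ := h.perfectStateDiscrimination B σ
        ((h.isNormalizedState_iff huB).2 hσ1) hint
      have hm1 : Θ.pair (m 1) ρ' = 1 := h1 1
      have hm0 : Θ.pair (m 1) σ = 0 := h2 1 0 (by decide)
      -- Internality of the marginal gives `m 1` positive probability, so the state it steers to can
      -- be normalized.
      obtain ⟨l', hl', G', hG''⟩ := hΨ.internal_right ρ'
      have hpos : 0 < Θ.pair uA (applyRight Ψ (m 1)) := by
        rw [← pair_prodEff_right, pair_prodEff_left, hG'', hm1, mul_one]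
        linarith [pair_nonneg (Θ := Θ) (m 1) G']
      obtain ⟨ρ, hρ⟩ := h.exists_normalization huA _ hpos
      refine ⟨a, ρ, hap, ?_⟩
      have hz : Θ.pair a' (applyRight Ψ (m 1)) = 0 := by
        rw [← pair_prodEff_right, pair_prodEff_left, hG', hσG, hm0, mul_zero]
      have := ha' (applyRight Ψ (m 1))
      rw [hz, add_zero] at this
      rw [hρ, ← this, inv_mul_cancel₀ hpos.ne']

/-- Every pure normalized state occurs with certainty for some extremal effect. -/
theorem Principles.exists_rayPure_effect (h : Θ.Principles) {A : Sys} {u : Effect A}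
    (hu : Θ.IsDeterministic u) {α : State A} (hα : Θ.RayPure α) (hα1 : Θ.pair u α = 1) :
    ∃ a : Effect A, Θ.RayPure a ∧ Θ.pair a α = 1 := by
  obtain ⟨ω, ε, hε, hω, hdom⟩ := h.exists_dominating hu hα1
  obtain ⟨B, uB, Ψ, huB, hΨ, -⟩ := h.exists_faithful hu hω (hdom.internal hε)
  obtain ⟨a, ρ, ha, haρ⟩ := hΨ.exists_rayPure_effect h hu huB
  have hρ1 : Θ.pair u ρ = 1 := le_antisymm (pair_le_one _ _) (haρ ▸ h.pair_le hu a ρ)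
  obtain ⟨U, rfl⟩ := h.exists_iso_of_rayPure hu hα (h.rayPure_of_pair_eq_one ha haρ) hα1 hρ1
  exact ⟨U.hom ≫ a, ha.iso_comp U, by rw [← pair_comp, haρ]⟩

/-! ### Conjugate effects and uniqueness of the effect certain on a state. -/

/-- The conjugate of an extremal effect: if `Ψ` extends an invariant state, the effect `a`, certain
on `α`, steers to `q β`, and an extremal effect that is certain on `β` steers to `q α`. -/
theorem Faithful.exists_conjugate (h : Θ.Principles) {A B : Sys} {uA : Effect A}
    {uB : Effect B} (huA : Θ.IsDeterministic uA) (huB : Θ.IsDeterministic uB)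
    {Ψ : State (A ⊗ B)} (hΨ : Θ.Faithful uA uB Ψ)
    (hinv : ∀ U : A ≅ A, applyRight Ψ uB ≫ U.hom = applyRight Ψ uB) {a : Effect A}
    (ha : Θ.RayPure a) {α : State A} (haα : Θ.pair a α = 1) :
    ∃ (q : ℝ) (β : State B) (b : Effect B), 0 < q ∧ Θ.RayPure b ∧ Θ.pair b β = 1 ∧
      (∀ c, Θ.pair c (applyLeft Ψ a) = q * Θ.pair c β) ∧
      ∀ c, Θ.pair c (applyRight Ψ b) = q * Θ.pair c α := by
  have hα := h.rayPure_of_pair_eq_one ha haα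
  have hα1 : Θ.pair uA α = 1 := le_antisymm (pair_le_one _ _) (haα ▸ h.pair_le huA a α)
  have hq : 0 < Θ.pair uB (applyLeft Ψ a) := by
    obtain ⟨l, hl, G, hG⟩ := hΨ.internal_left α
    rw [← pair_prodEff_left, pair_prodEff_right, hG, haα, mul_one]
    linarith [pair_nonneg (Θ := Θ) a G]
  obtain ⟨β, hβ⟩ := h.exists_normalization huB _ hq
  set q := Θ.pair uB (applyLeft Ψ a) with hqdef
  have hβ1 : Θ.pair uB β = 1 := by rw [hβ, ← hqdef, inv_mul_cancel₀ hq.ne']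
  have hβ' : ∀ c, Θ.pair c (applyLeft Ψ a) = q * Θ.pair c β := fun c => by
    rw [hβ, mul_inv_cancel_left₀ hq.ne']
  have hβp := hΨ.rayPure_of_applyLeft h huA huB ha hq hβ' hβ1
  obtain ⟨b, hb, hbβ⟩ := h.exists_rayPure_effect huB hβp hβ1
  have hab : Θ.pair a (applyRight Ψ b) = q := by
    rw [← pair_prodEff_right, pair_prodEff_left, hβ', hbβ, mul_one]
  have hp : 0 < Θ.pair uA (applyRight Ψ b) := hq.trans_le (hab ▸ h.pair_le huA a _)
  obtain ⟨α', hα'⟩ := h.exists_normalization huA _ hp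
  set p := Θ.pair uA (applyRight Ψ b) with hpdef
  have hα'1 : Θ.pair uA α' = 1 := by rw [hα', ← hpdef, inv_mul_cancel₀ hp.ne']
  have hα'' : ∀ c, Θ.pair c (applyRight Ψ b) = p * Θ.pair c α' := fun c => by
    rw [hα', mul_inv_cancel_left₀ hp.ne']
  have hα'p : Θ.RayPure α' := hΨ.symm.rayPure_of_applyLeft h huB huA hb hp
    (by rwa [applyLeft_braiding]) hα'1
  obtain ⟨U, hU⟩ := h.exists_iso_of_rayPure huA hα'p hα hα'1 hα1
  obtain ⟨b', -, hb'⟩ := h.exists_compl_effect huB b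
  -- By invariance the marginal also contains `p α`, the image of `p α'` under `U`, which is then
  -- steered by an effect `d`. Testing with `a` gives `p = q (d|β) ≤ q`, while `q = p (a|α') ≤ p`;
  -- equality makes `a` certain on `α'`.
  obtain ⟨d, hd⟩ := hΨ.exists_effect_right h (σ := applyRight Ψ b ≫ U.hom)
    (τ := applyRight Ψ b' ≫ U.hom) fun c => by
      rw [← hinv U, pair_comp, pair_comp, pair_comp, pair_applyRight_add hb']
  have hpq : p ≤ q := by
    have h1 : Θ.pair a (applyRight Ψ d) = p := by
      rw [hd, pair_comp, hα'', ← pair_comp, ← hU, haα, mul_one]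
    rw [← h1, ← pair_prodEff_right, pair_prodEff_left, hβ']
    exact mul_le_of_le_one_right hq.le (pair_le_one _ _)
  rw [hα''] at hab
  have hpq' : p = q := le_antisymm hpq (by
    rw [← hab]; exact mul_le_of_le_one_right hp.le (pair_le_one _ _))
  have haα' : Θ.pair a α' = 1 := by
    rw [hpq'] at hab
    exact mul_left_cancel₀ hq.ne' (by rw [hab, mul_one])
  obtain rfl := h.eq_of_pair_eq_one ha haα haα'
  exact ⟨q, β, b, hq, hb, hbβ, hβ', fun c => by rw [hα'', hpq']⟩

/-- An extremal effect is determined by the state on which it occurs with certainty. -/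
theorem Principles.effect_eq_of_pair_eq_one (h : Θ.Principles) {A : Sys} {a a' : Effect A}
    (ha : Θ.RayPure a) (ha' : Θ.RayPure a') {α : State A} (haα : Θ.pair a α = 1)
    (ha'α : Θ.pair a' α = 1) : a = a' := by
  obtain ⟨u, hu⟩ := h.exists_det_effect a
  have hα1 : Θ.pair u α = 1 := le_antisymm (pair_le_one _ _) (haα ▸ h.pair_le hu a α)
  obtain ⟨χ, ε, hε, hχ, hdom, hinv⟩ := h.exists_invariant hu hα1
  obtain ⟨B, uB, Ψ, huB, hΨ, rfl⟩ := h.exists_faithful hu hχ (hdom.internal hε)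
  obtain ⟨q, β, b, hq, hb, hbβ, hβ, hα⟩ := hΨ.exists_conjugate h hu huB hinv ha haα
  obtain ⟨q', β', b', hq', hb', hbβ', hβ', hα'⟩ := hΨ.exists_conjugate h hu huB hinv ha' ha'α
  -- Both conjugates steer to multiples of the same `α`, so they are proportional; since each
  -- attains the value `1`, the factor is `1`.
  have hbb : ∀ ρ, Θ.pair b' ρ = q' * q⁻¹ * Θ.pair b ρ :=
    hΨ.symm.pair_eq h huB fun c => by
      rw [applyLeft_braiding, applyLeft_braiding, hα, hα', mul_assoc,
        inv_mul_cancel_left₀ hq.ne']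
  have h1 : q' ≤ q := by
    have := pair_le_one (Θ := Θ) b' β
    rwa [hbb, hbβ, mul_one, ← div_eq_mul_inv, div_le_one hq] at this
  have h2 : q ≤ q' := by
    have h3 := hbβ'
    rw [hbb] at h3
    have h4 : q' * q⁻¹ * Θ.pair b β' ≤ q' * q⁻¹ :=
      mul_le_of_le_one_right (by positivity) (pair_le_one _ _)
    rwa [h3, ← div_eq_mul_inv, one_le_div hq] at h4
  obtain rfl := le_antisymm h1 h2
  have hbβ'' : Θ.pair b β' = 1 := by
    rwa [hbb, mul_inv_cancel₀ hq.ne', one_mul] at hbβ'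
  obtain rfl := h.eq_of_pair_eq_one hb hbβ hbβ''
  exact hΨ.effect_ext h hu (h.state_ext fun c => by rw [hβ, hβ'])

/-! ### The correspondence between pure normalized states and effects. -/

theorem exists_effect_of_isNormalizedState {A : Sys} {α : State A}
    (hα : Θ.IsNormalizedState α) : Nonempty (Effect A) := by
  by_contra hne
  rw [not_nonempty_iff] at hne
  -- Without effects the range is empty, and the empty set has no least upper bound in `ℝ`.
  rw [IsNormalizedState, Set.range_eq_empty] at hα
  linarith [hα.2 (show (0 : ℝ) ∈ upperBounds ∅ by simp)]

/-- Every pure normalized effect is certain on a unique state, which is pure. -/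
theorem Principles.exists_identified (h : Θ.Principles) {A : Sys} {a : Effect A}
    (ha : a ∈ Θ.PurEff₁ A) : ∃ α ∈ Θ.PurSt₁ A, Θ.Identifies a α := by
  obtain ⟨hap, α, hα⟩ := ha
  have har := h.rayPure_of_isPure_effect α hap
  obtain ⟨u, hu⟩ := h.exists_det_effect a
  refine ⟨α, ⟨(h.rayPure_of_pair_eq_one har hα).isPure h, (h.isNormalizedState_iff hu).2
    (le_antisymm (pair_le_one _ _) (hα ▸ h.pair_le hu a α))⟩, fun ρ => ⟨fun hρ => ?_, ?_⟩⟩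
  · exact h.eq_of_pair_eq_one har hρ hα
  · rintro rfl; exact hα

theorem Principles.effect_eq_of_identifies (h : Θ.Principles) {A : Sys} {a b : Effect A}
    {α : State A} (ha : Θ.IsPure a) (hb : Θ.IsPure b) (haα : Θ.Identifies a α)
    (hbα : Θ.Identifies b α) : a = b :=
  h.effect_eq_of_pair_eq_one (h.rayPure_of_isPure_effect α ha) (h.rayPure_of_isPure_effect α hb)
    ((haα α).2 rfl) ((hbα α).2 rfl)

/-- The map built directly is the inverse, from effects to the states they identify: injective
because a state determines its effect, surjective because each pure state has a certain extremal
effect. -/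
theorem Principles.exists_dagger (h : Θ.Principles) (A : Sys) :
    ∃ dag : Θ.PurSt₁ A → Θ.PurEff₁ A, Function.Bijective dag ∧
      ∀ α : Θ.PurSt₁ A, Θ.pair (dag α : Effect A) (α : State A) = 1 := by
  choose g hg hid using fun a : Θ.PurEff₁ A => h.exists_identified a.2
  let f : Θ.PurEff₁ A → Θ.PurSt₁ A := fun a => ⟨g a, hg a⟩
  have hf : Function.Bijective f := by
    refine ⟨fun a b hab => Subtype.ext ?_, fun α => ?_⟩
    · have hab' : g a = g b := congrArg Subtype.val hab
      exact h.effect_eq_of_identifies a.2.1 b.2.1 (hid a) (hab' ▸ hid b)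
    · obtain ⟨a₀⟩ := exists_effect_of_isNormalizedState α.2.2
      obtain ⟨u, hu⟩ := h.exists_det_effect a₀
      obtain ⟨a, ha, haα⟩ := h.exists_rayPure_effect hu (h.rayPure_of_isPure_state hu α.2.1)
        ((h.isNormalizedState_iff hu).1 α.2.2)
      exact ⟨⟨a, ha.isPure h, α, haα⟩, Subtype.ext ((hid ⟨a, ha.isPure h, α, haα⟩ _).1 haα).symm⟩
  let e := Equiv.ofBijective f hf
  refine ⟨e.symm, e.symm.bijective, fun α => ?_⟩
  have := (hid (e.symm α) (g (e.symm α))).2 rfl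
  have h2 : g (e.symm α) = α := congrArg Subtype.val (e.apply_symm_apply α)
  rwa [h2] at this

end OPT

theorem mainTheorem3 {Sys : Type u} [Category.{v} Sys] [MonoidalCategory Sys]
    [SymmetricCategory Sys] (Θ : OPT Sys)
    (separation : Θ.SeparationProperty)
    (coarseGraining : Θ.ClosedUnderCoarseGraining)
    (finiteDim : Θ.FiniteDimensionalSystems)
    (nonDet : Θ.NonDeterministic)
    (limits : Θ.ClosedUnderLimits)
    (causality : Θ.Causality)
    (purityOfComposition : Θ.PurityOfComposition)
    (localTomography : Θ.LocalTomography)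
    (perfectStateDiscrimination : Θ.PerfectStateDiscrimination)
    (idealCompression : Θ.IdealCompression)
    (purification : Θ.Purification)
    (A : Sys) :
    (∃ dag : Θ.PurSt₁ A → Θ.PurEff₁ A, Function.Bijective dag ∧
      ∀ α : Θ.PurSt₁ A, Θ.pair (dag α : OPT.Effect A) (α : OPT.State A) = 1) ∧
    (∀ a ∈ Θ.PurEff₁ A, ∃! α : OPT.State A, α ∈ Θ.PurSt₁ A ∧ Θ.Identifies a α) ∧
    (∀ (a b : OPT.Effect A) (α : OPT.State A), Θ.IsPure a → Θ.IsPure b →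
      Θ.Identifies a α → Θ.Identifies b α → a = b) := by
  have h : Θ.Principles := ⟨separation, coarseGraining, finiteDim, nonDet, limits, causality,
    purityOfComposition, localTomography, perfectStateDiscrimination, idealCompression,
    purification⟩
  refine ⟨h.exists_dagger A, fun a ha => ?_, fun a b α ha hb haα hbα =>
    h.effect_eq_of_identifies ha hb haα hbα⟩
  obtain ⟨α, hα, hid⟩ := h.exists_identified ha
  exact ⟨α, ⟨hα, hid⟩, fun β hβ => (hid β).1 ((hβ.2 β).2 rfl)⟩
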